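/- Let $\phi:[0,\infty)\to[0,\infty)$ be an Orlicz function, that is, $\phi(0)=0$, $\phi$ is continuous, strictly increasing and $\lim_{u\to\infty}\phi(u)=\infty$ ($\phi$ need not be convex). Let $(\Omega,\Sigma,\mu)$ be one of the following measure spaces: (A) $\sigma$-finite, nonatomic, $\mu(\Omega)=\infty$; (B) nonatomic, $0<\mu(\Omega)<\infty$; (C) $\mathbb N$ with the counting measure. Define the Matuszewska–Orlicz indices in $[-\infty,\infty]$ by $$\alpha_\phi=\sup\{p\in\mathbb R:\ \exists c>0\ \ \phi(au)\ge c\,a^p\phi(u)\},\qquad \beta_\phi=\inf\{p\in\mathbb R:\ \exists c>0\ \ \phi(au)\le c\,a^p\phi(u)\}$$ (with $\inf\emptyset=\infty$), where the inequality is required in case (A) for all $a\ge1$, $u\ge0$; in case (B), for some $v\ge0$, for all $a\ge1$, $u\ge v$; in case (C), for some $v>0$, for all $a\ge 1$, $u>0$ with $au\le v$. Assume that $\alpha_\phi>0$. Let $L_\phi$ be the space of (classes of) measurable $f:\Omega\to\mathbb R$ with $\int_\Omega\phi(\lambda|f|)\,d\mu<\infty$ for some $\lambda>0$, with the quasi-norm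 $\|f\|=\inf\{\varepsilon>0:\int_\Omega\phi(|f|/\varepsilon)\,d\mu\le1\}$. Let $r_n(t)=\operatorname{sign}(\sin 2^n\pi t)$, $n\geq 1$, be the Rademacher functions. For $0<p<\infty$ say that $L_\phi$ has type $p$ if there is $K>0$ with $\int_0^1\|\sum_{k=1}^n r_k(t)x_k\|\,dt\le K(\sum_{k=1}^n\|x_k\|^p)^{1/p}$ for all finite families $x_1,\dots,x_n\in L_\phi$, and for $0<q\le\infty$ that it has cotype $q$ if there is $K>0$ with $(\sum_{k=1}^n\|x_k\|^q)^{1/q}\le K\int_0^1\|\sum_{k=1}^n r_k(t)x_k\|\,dt$ for all such families (for $q=\infty$ the left side is $\max_k\|x_k\|$). A type $p$ is called nontrivial if $p>1$. I. $L_\phi$ has cotype $\max(\beta_\phi+\varepsilon,2)$ for every $\varepsilon>0$. If $L_\phi$ has a finite cotype $q$, then $q\ge\max(\beta_\phi,2)$. II. If $\beta_\phi<\infty$, then $L_\phi$ has type $\min(\alpha_\phi-\varepsilon,2)$ for every $\varepsilon>0$ with $\alpha_\phi-\varepsilon>0$. If $L_\phi$ has a nontrivial type $p$, then $\beta_\phi<\infty$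 and $p\le\min(\alpha_\phi,2)$. -/

import Mathlib

open MeasureTheory Filter Topology
open scoped NNReal ENNReal

/-- An Orlicz function: a strictly increasing continuous `φ : [0, ∞) → [0, ∞)` with `φ 0 = 0` and
`φ u → ∞` as `u → ∞`.  Convexity is not required. -/
structure OrliczFunction where
  toFun : ℝ≥0 → ℝ≥0
  map_zero : toFun 0 = 0
  strictMono : StrictMono toFun
  continuous : Continuous toFun
  tendsto_atTop : Tendsto toFun atTop atTop

instance : CoeFun OrliczFunction (fun _ => ℝ≥0 → ℝ≥0) := ⟨OrliczFunction.toFun⟩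

/-- The three versions of the growth conditions: for all, for large, for small arguments. -/
inductive ArgumentRange
  | all
  | large
  | small

/-- "`P a u` for all `a ≥ 1` and all arguments `u`" in the sense of the given range:
`u ≥ 0` for all arguments; `u ≥ v` for some `v ≥ 0` for large arguments;
`0 < u ≤ a u ≤ v` for some `v > 0` for small arguments. -/
def ArgumentRange.Holds (r : ArgumentRange) (P : ℝ≥0 → ℝ≥0 → Prop) : Prop :=
  match r with
  | .all => ∀ a u : ℝ≥0, 1 ≤ a → P a u
  | .large => ∃ v : ℝ≥0, ∀ a u : ℝ≥0, 1 ≤ a → v ≤ u → P a u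
  | .small => ∃ v : ℝ≥0, 0 < v ∧ ∀ a u : ℝ≥0, 1 ≤ a → 0 < u → a * u ≤ v → P a u

namespace OrliczFunction

/-- The lower Matuszewska-Orlicz index, as an extended real number. -/
noncomputable def lowerIndex (φ : OrliczFunction) (r : ArgumentRange) : EReal :=
  sSup {x : EReal | ∃ p : ℝ, x = (p : EReal) ∧
    ∃ c : ℝ≥0, 0 < c ∧ r.Holds (fun a u => c * a ^ p * φ u ≤ φ (a * u))}

/-- The upper Matuszewska-Orlicz index, as an extended real number (`⊤` if no exponent works). -/
noncomputable def upperIndex (φ : OrliczFunction) (r : ArgumentRange) : EReal :=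
  sInf {x : EReal | ∃ p : ℝ, x = (p : EReal) ∧
    ∃ c : ℝ≥0, 0 < c ∧ r.Holds (fun a u => φ (a * u) ≤ c * a ^ p * φ u)}

variable {Ω : Type*} [MeasurableSpace Ω]

/-- The modular `I_φ(f) = ∫ φ(|f|) dμ ∈ [0, ∞]` on (classes of) measurable real functions. -/
noncomputable def modular (φ : OrliczFunction) (μ : Measure Ω) (f : Ω →ₘ[μ] ℝ) : ℝ≥0∞ :=
  ∫⁻ t, (φ ‖f t‖₊ : ℝ≥0∞) ∂μ

theorem modular_mono (φ : OrliczFunction) (μ : Measure Ω) {f g : Ω →ₘ[μ] ℝ}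
    (h : ∀ᵐ t ∂μ, ‖f t‖₊ ≤ ‖g t‖₊) : φ.modular μ f ≤ φ.modular μ g := by
  refine lintegral_mono_ae ?_
  filter_upwards [h] with t ht
  exact_mod_cast φ.strictMono.monotone ht

theorem modular_add_half_le (φ : OrliczFunction) (μ : Measure Ω) {l m : ℝ} (hl : 0 < l)
    (hm : 0 < m) (f g : Ω →ₘ[μ] ℝ) :
    φ.modular μ ((min l m / 2) • (f + g)) ≤ φ.modular μ (l • f) + φ.modular μ (m • g) := by
  have hmeas : AEMeasurable (fun t => (φ ‖(l • f) t‖₊ : ℝ≥0∞)) μ :=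
    (φ.continuous.measurable.comp_aemeasurable
      (l • f).aestronglyMeasurable.aemeasurable.nnnorm).coe_nnreal_ennreal
  unfold modular
  rw [← lintegral_add_left' hmeas]
  refine lintegral_mono_ae ?_
  filter_upwards [AEEqFun.coeFn_smul (min l m / 2) (f + g), AEEqFun.coeFn_add f g,
    AEEqFun.coeFn_smul l f, AEEqFun.coeFn_smul m g] with t h1 h2 h3 h4
  rw [h1, h3, h4, Pi.smul_apply, Pi.smul_apply, Pi.smul_apply, h2, Pi.add_apply]
  have hmin : 0 < min l m := lt_min hl hm
  have key : ‖(min l m / 2) • (f t + g t)‖ ≤ max ‖l • f t‖ ‖m • g t‖ := by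
    simp only [smul_eq_mul, norm_mul, Real.norm_eq_abs]
    rw [abs_of_pos (half_pos hmin), abs_of_pos hl, abs_of_pos hm]
    have h5 : min l m * |f t| ≤ l * |f t| :=
      mul_le_mul_of_nonneg_right (min_le_left _ _) (abs_nonneg _)
    have h6 : min l m * |g t| ≤ m * |g t| :=
      mul_le_mul_of_nonneg_right (min_le_right _ _) (abs_nonneg _)
    have h7 : min l m * |f t + g t| ≤ min l m * (|f t| + |g t|) :=
      mul_le_mul_of_nonneg_left (abs_add_le _ _) hmin.le
    have h8 := le_max_left (l * |f t|) (m * |g t|)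
    have h9 := le_max_right (l * |f t|) (m * |g t|)
    linarith
  have key' : ‖(min l m / 2) • (f t + g t)‖₊ ≤ max ‖l • f t‖₊ ‖m • g t‖₊ := by
    exact_mod_cast key
  have h10 : φ ‖(min l m / 2) • (f t + g t)‖₊ ≤ φ ‖l • f t‖₊ + φ ‖m • g t‖₊ := by
    refine (φ.strictMono.monotone key').trans ?_
    rcases max_cases ‖l • f t‖₊ ‖m • g t‖₊ with h | h <;> rw [h.1]
    · exact le_self_add
    · exact le_add_self
  exact_mod_cast h10

/-- The Orlicz space `L_φ`: all (classes of) measurable real functions `f` with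
`I_φ(l f) < ∞` for some `l > 0`. -/
noncomputable def space (φ : OrliczFunction) (μ : Measure Ω) : Submodule ℝ (Ω →ₘ[μ] ℝ) where
  carrier := {f | ∃ l : ℝ, 0 < l ∧ φ.modular μ (l • f) < ∞}
  zero_mem' := by
    refine ⟨1, one_pos, ?_⟩
    have h : φ.modular μ ((1 : ℝ) • (0 : Ω →ₘ[μ] ℝ)) = 0 := by
      rw [smul_zero]
      unfold modular
      rw [lintegral_congr_ae (g := fun _ => 0), lintegral_zero]
      filter_upwards [AEEqFun.coeFn_zero (α := Ω) (β := ℝ) (μ := μ)] with t ht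
      simp [ht, φ.map_zero]
    rw [h]
    exact ENNReal.zero_lt_top
  add_mem' := by
    rintro f g ⟨l, hl, hf⟩ ⟨m, hm, hg⟩
    exact ⟨min l m / 2, half_pos (lt_min hl hm),
      (φ.modular_add_half_le μ hl hm f g).trans_lt (ENNReal.add_lt_top.2 ⟨hf, hg⟩)⟩
  smul_mem' := by
    rintro c f ⟨l, hl, hf⟩
    have hc : 0 < |c| + 1 := by positivity
    refine ⟨l / (|c| + 1), div_pos hl hc, lt_of_le_of_lt (φ.modular_mono μ ?_) hf⟩
    rw [smul_smul]
    filter_upwards [AEEqFun.coeFn_smul (l / (|c| + 1) * c) f, AEEqFun.coeFn_smul l f] with t h1 h2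
    rw [h1, h2, Pi.smul_apply, Pi.smul_apply]
    have h : ‖(l / (|c| + 1) * c) • f t‖ ≤ ‖l • f t‖ := by
      rw [norm_smul, norm_smul]
      refine mul_le_mul_of_nonneg_right ?_ (norm_nonneg _)
      rw [Real.norm_eq_abs, Real.norm_eq_abs, abs_mul, abs_div, abs_of_pos hl, abs_of_pos hc,
        div_mul_eq_mul_div, div_le_iff₀ hc]
      exact mul_le_mul_of_nonneg_left (by linarith) hl.le
    exact_mod_cast h

/-- The Minkowski functional `‖f‖_φ = inf {ε > 0 : I_φ(f / ε) ≤ 1}` on `L_φ`. -/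
noncomputable def luxemburg (φ : OrliczFunction) (μ : Measure Ω) (f : φ.space μ) : ℝ :=
  sInf {ε : ℝ | 0 < ε ∧ φ.modular μ (ε⁻¹ • (f : Ω →ₘ[μ] ℝ)) ≤ 1}

end OrliczFunction

/-- A nonatomic measure: every measurable set of positive measure contains a measurable subset
of positive and strictly smaller measure. -/
def MeasureTheory.Measure.IsNonatomic {Ω : Type*} [MeasurableSpace Ω] (μ : Measure Ω) : Prop :=
  ∀ A : Set Ω, MeasurableSet A → 0 < μ A → ∃ B ⊆ A, MeasurableSet B ∧ 0 < μ B ∧ μ B < μ A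

/-- The class of measure spaces that goes with each range of arguments: nonatomic infinite
(σ-finite) measure with all arguments; nonatomic finite nonzero measure with large arguments;
the counting measure on (a copy of) `ℕ` with small arguments. -/
def ArgumentRange.Matches (r : ArgumentRange) {Ω : Type*} [MeasurableSpace Ω]
    (μ : Measure Ω) : Prop :=
  match r with
  | .all => SigmaFinite μ ∧ μ.IsNonatomic ∧ μ Set.univ = ∞
  | .large => μ.IsNonatomic ∧ 0 < μ Set.univ ∧ μ Set.univ < ∞
  | .small => ∃ e : Ω ≃ᵐ ℕ, MeasurePreserving e μ Measure.count

/-- The Rademacher functions `r_n(t) = sign (sin (2 ^ n π t))`, used for `n ≥ 1`. -/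
noncomputable def rademacher (n : ℕ) (t : ℝ) : ℝ :=
  Real.sign (Real.sin (2 ^ n * Real.pi * t))

section TypeCotype

variable {X : Type*} [AddCommGroup X] [Module ℝ X]

/-- `∫₀¹ N(∑ₖ rₖ(t) xₖ) dt` for vectors `x₁, …, xₙ` (here indexed by `0, …, n - 1`). -/
noncomputable def rademacherAverage (N : X → ℝ) {n : ℕ} (x : Fin n → X) : ℝ :=
  ∫ t in (0 : ℝ)..1, N (∑ k : Fin n, rademacher (k + 1) t • x k)

/-- The space `X` with the quasi-norm `N` has type `p`.  Exponents `p > 2` are not excluded by the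
definition. -/
def HasType (N : X → ℝ) (p : ℝ) : Prop :=
  0 < p ∧ ∃ K : ℝ, 0 < K ∧ ∀ (n : ℕ) (x : Fin n → X),
    rademacherAverage N x ≤ K * (∑ k, N (x k) ^ p) ^ (1 / p)

/-- `(∑ₖ aₖ ^ q) ^ (1 / q)` for `0 < q < ∞`, and `maxₖ aₖ` for `q = ∞` (`aₖ ≥ 0`). -/
noncomputable def lqSum (q : EReal) {n : ℕ} (a : Fin n → ℝ) : ℝ :=
  if q = ⊤ then ⨆ k, a k else (∑ k, a k ^ q.toReal) ^ (1 / q.toReal)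

/-- The space `X` with the quasi-norm `N` has cotype `q`, where `0 < q ≤ ∞`.  Exponents `q < 2` are
not excluded by the definition. -/
def HasCotype (N : X → ℝ) (q : EReal) : Prop :=
  0 < q ∧ ∃ K : ℝ, 0 < K ∧ ∀ (n : ℕ) (x : Fin n → X),
    lqSum q (fun k => N (x k)) ≤ K * rademacherAverage N x

end TypeCotype

/-! Everything is done with modulars and pointwise inequalities, since convexity is not available.
Rademacher averages are averages over all sign patterns.

Sufficiency. On a matching measure space, `φ` can be replaced by a function `ψ` whose growth
estimates hold for all arguments (`exists_modularComparison`): `φ` is continued by a power on the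
irrelevant range, and the two modulars still control each other. Growth faster than `u ^ p` gives a
weak Jensen inequality, hence a modular bound for `(∑ |x_k|^p)^(1/p)` by the `ℓ_p` sum of the
quasi-norms (`exists_convexity`); growth slower than `u ^ s` gives the reverse inequality. For `p ≤
1`, signed sums are dominated pointwise by the `ℓ_p` function. For `1 ≤ p ≤ 2`, Khintchine's
inequality for `ψ`, valid because `ψ` grows at most polynomially, bounds the mean modular of the
signed sums by that of the square function, hence of the `ℓ_p` function. For cotype, Paley-Zygmund
together with Markov's inequality bounds the square function by the Rademacher average without any
upper growth (`exists_squareFunction_le`). Cotype `∞` follows at once, and cotype `s ≥ 2` by the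
reverse Jensen inequality and `ℓ_2 ⊆ ℓ_s`.

Necessity. Constant families reduce to scalars and give `p ≤ 2 ≤ q`. Disjoint multiples of
indicators of sets of equal measure have signed sums of constant modulus; type `p` and cotype `q`
then compare `φ (a u)` with `φ u`, the number of sets being of order `a ^ p` or `a ^ q`. Finally `2
^ n` disjoint cells carry a copy of `n` Rademacher vectors in `ℓ_∞`, whose signed sums all have sup
norm `n`; type `p > 1` makes this incompatible with a failure of the doubling condition, so the
upper index is finite. -/

/-! ### Rademacher averages as averages over signs. -/

/-- The real sign attached to a Boolean. -/
def boolSign (b : Bool) : ℝ := cond b 1 (-1)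

@[simp] theorem boolSign_true : boolSign true = 1 := rfl

@[simp] theorem boolSign_false : boolSign false = -1 := rfl

theorem abs_boolSign (b : Bool) : |boolSign b| = 1 := by cases b <;> simp

theorem nnnorm_boolSign (b : Bool) : ‖boolSign b‖₊ = 1 := by
  rw [← NNReal.coe_inj]; simpa using abs_boolSign b

theorem sum_bool_fin_succ {M : Type*} [AddCommMonoid M] {n : ℕ} (F : (Fin (n + 1) → Bool) → M) :
    ∑ ε, F ε = (∑ ε : Fin n → Bool, F (Fin.cons true ε)) +
      ∑ ε : Fin n → Bool, F (Fin.cons false ε) := by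
  rw [← (Fin.consEquiv (fun _ : Fin (n + 1) => Bool)).sum_comp, Fintype.sum_prod_type,
    Fintype.sum_bool]
  rfl

/-- The vector of the first `n` Rademacher functions. -/
noncomputable def rademacherVector (n : ℕ) (t : ℝ) : Fin n → ℝ :=
  fun k => rademacher (k + 1) t

theorem rademacher_succ_succ (k : ℕ) (t : ℝ) :
    rademacher (k + 2) t = rademacher (k + 1) (2 * t) := by
  unfold rademacher
  congr 2
  ring

theorem rademacher_succ_sub_one (k : ℕ) (t : ℝ) :
    rademacher (k + 1) (t - 1) = rademacher (k + 1) t := by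
  unfold rademacher
  congr 1
  have h : (2 : ℝ) ^ (k + 1) * Real.pi * (t - 1) =
      2 ^ (k + 1) * Real.pi * t - ((2 ^ k : ℕ) : ℝ) * (2 * Real.pi) := by
    push_cast; ring
  rw [h, Real.sin_sub_nat_mul_two_pi]

theorem rademacher_one_left {t : ℝ} (h0 : 0 < t) (h1 : t < 1 / 2) : rademacher 1 t = 1 := by
  unfold rademacher
  refine Real.sign_of_pos (Real.sin_pos_of_pos_of_lt_pi (by positivity) ?_)
  nlinarith [Real.pi_pos]

theorem rademacher_one_right {t : ℝ} (h0 : 1 / 2 < t) (h1 : t < 1) : rademacher 1 t = -1 := by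
  unfold rademacher
  refine Real.sign_of_neg ?_
  have h : (2 : ℝ) ^ 1 * Real.pi * t = (2 * t - 1) * Real.pi + Real.pi := by ring
  rw [h, Real.sin_add_pi, neg_lt_zero]
  refine Real.sin_pos_of_pos_of_lt_pi (mul_pos (by linarith) Real.pi_pos) ?_
  nlinarith [Real.pi_pos]

theorem rademacherVector_left (n : ℕ) {t : ℝ} (h0 : 0 < t) (h1 : t < 1 / 2) :
    rademacherVector (n + 1) t = Fin.cons 1 (rademacherVector n (2 * t)) := by
  funext k
  refine Fin.cases ?_ (fun k => ?_) k
  · simpa [rademacherVector] using rademacher_one_left h0 h1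
  · simpa [rademacherVector] using rademacher_succ_succ k t

theorem rademacherVector_right (n : ℕ) {t : ℝ} (h0 : 1 / 2 < t) (h1 : t < 1) :
    rademacherVector (n + 1) t = Fin.cons (-1) (rademacherVector n (2 * t - 1)) := by
  funext k
  refine Fin.cases ?_ (fun k => ?_) k
  · simpa [rademacherVector] using rademacher_one_right h0 h1
  · simp only [rademacherVector, Fin.val_succ, Fin.cons_succ]
    rw [rademacher_succ_sub_one]
    exact rademacher_succ_succ k t

/-- On each half of the unit interval the first Rademacher function is constant and the remaining
ones are the whole system run at double speed. Induction on `n` therefore splits the integral as it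
splits sign patterns by their first entry; integrability is carried along to glue the halves. -/
theorem integral_rademacherVector (n : ℕ) (F : (Fin n → ℝ) → ℝ) :
    IntervalIntegrable (fun t => F (rademacherVector n t)) volume 0 1 ∧
      ∫ t in (0 : ℝ)..1, F (rademacherVector n t) =
        (2 ^ n : ℝ)⁻¹ * ∑ ε : Fin n → Bool, F (fun k => boolSign (ε k)) := by
  induction n with
  | zero =>
    have h : (fun t => F (rademacherVector 0 t)) = fun _ => F ![] := by
      funext t; congr 1; exact Subsingleton.elim _ _
    refine ⟨by rw [h]; simp, ?_⟩
    rw [h]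
    simp only [intervalIntegral.integral_const, sub_zero, one_smul, pow_zero, inv_one, one_mul,
      Finset.univ_unique, Finset.sum_singleton]
    congr 1
    exact Subsingleton.elim _ _
  | succ n ih =>
    obtain ⟨i1, e1⟩ := ih (fun v => F (Fin.cons 1 v))
    obtain ⟨i2, e2⟩ := ih (fun v => F (Fin.cons (-1) v))
    -- Only the open halves agree: at the endpoints the sign of the sine is 0.
    have c1 : Set.EqOn (fun t => F (Fin.cons 1 (rademacherVector n (2 * t))))
        (fun t => F (rademacherVector (n + 1) t)) (Set.uIoo 0 (1 / 2)) := by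
      intro t ht
      rw [Set.uIoo_of_le (by norm_num)] at ht
      simp only [rademacherVector_left n ht.1 ht.2]
    have c2 : Set.EqOn (fun t => F (Fin.cons (-1) (rademacherVector n (2 * t - 1))))
        (fun t => F (rademacherVector (n + 1) t)) (Set.uIoo (1 / 2) 1) := by
      intro t ht
      rw [Set.uIoo_of_le (by norm_num)] at ht
      simp only [rademacherVector_right n ht.1 ht.2]
    have j1 := (i1.comp_mul_left (c := 2)).congr_uIoo (g := fun t => F (rademacherVector (n + 1) t))
      (by simpa using c1)
    have j2 := ((i2.comp_sub_right 1).comp_mul_left (c := 2)).congr_uIoo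
      (g := fun t => F (rademacherVector (n + 1) t)) (by
        rw [Set.uIoo_of_le (by norm_num)] at c2
        norm_num
        simpa using c2)
    norm_num at j1 j2
    refine ⟨j1.trans j2, ?_⟩
    rw [← intervalIntegral.integral_add_adjacent_intervals j1 j2,
      ← intervalIntegral.integral_congr_uIoo c1, ← intervalIntegral.integral_congr_uIoo c2,
      intervalIntegral.integral_comp_mul_left
        (fun t => F (Fin.cons 1 (rademacherVector n t))) two_ne_zero,
      intervalIntegral.integral_comp_mul_sub
        (fun t => F (Fin.cons (-1) (rademacherVector n t))) two_ne_zero]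
    norm_num
    rw [e1, e2, sum_bool_fin_succ, pow_succ, mul_inv, mul_add]
    have h : ∀ (b : Bool) (ε : Fin n → Bool), (fun k => boolSign ((Fin.cons b ε : Fin (n + 1) → Bool) k)) =
        (Fin.cons (boolSign b) (fun k => boolSign (ε k)) : Fin (n + 1) → ℝ) := by
      intro b ε
      funext k
      refine Fin.cases ?_ (fun k => ?_) k <;> simp
    simp only [h, boolSign_true, boolSign_false]
    ring

theorem rademacherAverage_eq {X : Type*} [AddCommGroup X] [Module ℝ X] (N : X → ℝ) {n : ℕ}
    (x : Fin n → X) :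
    rademacherAverage N x =
      (2 ^ n : ℝ)⁻¹ * ∑ ε : Fin n → Bool, N (∑ k, boolSign (ε k) • x k) :=
  (integral_rademacherVector n (fun v => N (∑ k, v k • x k))).2

theorem rademacherAverage_le {X : Type*} [AddCommGroup X] [Module ℝ X] {N : X → ℝ} {n : ℕ}
    {x : Fin n → X} {M : ℝ} (h : ∀ ε : Fin n → Bool, N (∑ k, boolSign (ε k) • x k) ≤ M) :
    rademacherAverage N x ≤ M := by
  rw [rademacherAverage_eq]
  have := Finset.sum_le_sum (fun ε (_ : ε ∈ Finset.univ) => h ε)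
  simp only [Finset.sum_const, Finset.card_univ, Fintype.card_fun, Fintype.card_bool,
    Fintype.card_fin, nsmul_eq_mul] at this
  rw [inv_mul_le_iff₀ (by positivity)]
  exact_mod_cast this

theorem le_rademacherAverage {X : Type*} [AddCommGroup X] [Module ℝ X] {N : X → ℝ} {n : ℕ}
    {x : Fin n → X} {M : ℝ} (h : ∀ ε : Fin n → Bool, M ≤ N (∑ k, boolSign (ε k) • x k)) :
    M ≤ rademacherAverage N x := by
  rw [rademacherAverage_eq]
  have := Finset.sum_le_sum (fun ε (_ : ε ∈ Finset.univ) => h ε)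
  simp only [Finset.sum_const, Finset.card_univ, Fintype.card_fun, Fintype.card_bool,
    Fintype.card_fin, nsmul_eq_mul] at this
  rw [le_inv_mul_iff₀ (by positivity)]
  exact_mod_cast this

/-! ### Moments of signed sums. -/

/-- The signed sum `∑ ± aₖ`. -/
noncomputable def signedSum {n : ℕ} (a : Fin n → ℝ) (ε : Fin n → Bool) : ℝ :=
  ∑ k, boolSign (ε k) * a k

theorem signedSum_cons {n : ℕ} (a : Fin (n + 1) → ℝ) (b : Bool) (ε : Fin n → Bool) :
    signedSum a (Fin.cons b ε) = signedSum (fun k => a k.succ) ε + boolSign b * a 0 := by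
  simp [signedSum, Fin.sum_univ_succ, add_comm]

theorem sum_signedSum_sq {n : ℕ} (a : Fin n → ℝ) :
    ∑ ε, signedSum a ε ^ 2 = 2 ^ n * ∑ k, a k ^ 2 := by
  induction n with
  | zero => simp [signedSum]
  | succ n ih =>
    rw [sum_bool_fin_succ, ← Finset.sum_add_distrib, Fin.sum_univ_succ]
    simp only [signedSum_cons, boolSign_true, boolSign_false]
    have h : ∀ s : ℝ, (s + 1 * a 0) ^ 2 + (s + -1 * a 0) ^ 2 = 2 * s ^ 2 + 2 * a 0 ^ 2 := by
      intro s; ring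
    simp only [h, Finset.sum_add_distrib, ← Finset.mul_sum, ih, Finset.sum_const, Finset.card_univ,
      Fintype.card_fun, Fintype.card_bool, Fintype.card_fin, nsmul_eq_mul]
    push_cast
    ring

/-- Pairing the two signs of one coefficient kills the odd powers, and the mixed term `12 a₀² s²` is
exactly what `3 (V + a₀²)²` produces; the `a₀⁴` terms leave slack. -/
theorem sum_signedSum_pow_four_le {n : ℕ} (a : Fin n → ℝ) :
    ∑ ε, signedSum a ε ^ 4 ≤ 3 * 2 ^ n * (∑ k, a k ^ 2) ^ 2 := by
  induction n with
  | zero => simp [signedSum]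
  | succ n ih =>
    rw [sum_bool_fin_succ, ← Finset.sum_add_distrib, Fin.sum_univ_succ]
    simp only [signedSum_cons, boolSign_true, boolSign_false]
    have h : ∀ s : ℝ, (s + 1 * a 0) ^ 4 + (s + -1 * a 0) ^ 4 =
        2 * s ^ 4 + 12 * a 0 ^ 2 * s ^ 2 + 2 * a 0 ^ 4 := by
      intro s; ring
    simp only [h, Finset.sum_add_distrib, ← Finset.mul_sum, sum_signedSum_sq, Finset.sum_const,
      Finset.card_univ, Fintype.card_fun, Fintype.card_bool, Fintype.card_fin, nsmul_eq_mul]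
    push_cast
    have := ih (fun k => a k.succ)
    have h2 : (0 : ℝ) ≤ 2 ^ n * a 0 ^ 4 := by positivity
    rw [pow_succ 2 n]
    nlinarith

/-- The exponential factorizes over the coefficients, and each factor satisfies `cosh a ≤ exp (a² /
2)`. -/
theorem sum_exp_signedSum_le {n : ℕ} (a : Fin n → ℝ) :
    ∑ ε, Real.exp (signedSum a ε) ≤ 2 ^ n * Real.exp ((∑ k, a k ^ 2) / 2) := by
  induction n with
  | zero => simp [signedSum]
  | succ n ih =>
    rw [sum_bool_fin_succ, ← Finset.sum_add_distrib, Fin.sum_univ_succ]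
    simp only [signedSum_cons, boolSign_true, boolSign_false, Real.exp_add, ← mul_add,
      ← Finset.sum_mul, add_div, one_mul, neg_one_mul]
    have h1 := ih (fun k => a k.succ)
    have h2 := Real.cosh_le_exp_half_sq (a 0)
    rw [Real.cosh_eq, div_le_iff₀ two_pos] at h2
    calc _ ≤ (2 ^ n * Real.exp ((∑ k : Fin n, a k.succ ^ 2) / 2)) * (Real.exp (a 0 ^ 2 / 2) * 2) :=
          mul_le_mul h1 h2 (by positivity) (by positivity)
      _ = _ := by ring

theorem sum_exp_abs_signedSum_le {n : ℕ} (a : Fin n → ℝ) :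
    ∑ ε, Real.exp |signedSum a ε| ≤ 2 ^ n * (2 * Real.exp ((∑ k, a k ^ 2) / 2)) := by
  have h1 := sum_exp_signedSum_le a
  have h2 := sum_exp_signedSum_le (fun k => -a k)
  have h3 : ∀ ε, signedSum (fun k => -a k) ε = -signedSum a ε := by
    intro ε; simp [signedSum]
  simp only [h3, neg_sq] at h2
  have h4 : ∑ ε, Real.exp |signedSum a ε| ≤
      ∑ ε, Real.exp (signedSum a ε) + ∑ ε, Real.exp (-signedSum a ε) := by
    rw [← Finset.sum_add_distrib]
    refine Finset.sum_le_sum fun ε _ => ?_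
    rcases abs_cases (signedSum a ε) with h | h <;> rw [h.1]
    · linarith [Real.exp_pos (-signedSum a ε)]
    · linarith [Real.exp_pos (signedSum a ε)]
  linarith

/-- A Paley-Zygmund inequality for signed sums. -/
theorem card_signedSum_ge {n : ℕ} (a : Fin n → ℝ) :
    (2 ^ n : ℝ) * (3 / 14) ≤
      ((Finset.univ.filter fun ε => ∑ k, a k ^ 2 ≤ 4 * signedSum a ε ^ 2).card : ℝ) := by
  set V := ∑ k, a k ^ 2 with hV
  have hV0 : 0 ≤ V := Finset.sum_nonneg fun k _ => sq_nonneg _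
  rcases hV0.eq_or_lt with h0 | h0
  · rw [← h0, Finset.filter_true_of_mem (fun ε _ => by positivity)]
    simp only [Finset.card_univ, Fintype.card_fun, Fintype.card_bool, Fintype.card_fin]
    push_cast
    nlinarith [show (0 : ℝ) < 2 ^ n by positivity]
  -- With `x = signedSum a ε ^ 2`, the quadratic `8 V x - x² - 2 V²` is nonpositive for `x < V / 4`
  -- and has maximum `14 V²` at `x = 4 V`. By the second and fourth moments its mean is at least `8
  -- V² - 3 V² - 2 V² = 3 V²`, whence `3 / 14`.
  · have key : ∀ ε, 8 * V * signedSum a ε ^ 2 - signedSum a ε ^ 4 - 2 * V ^ 2 ≤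
        14 * V ^ 2 * (if V ≤ 4 * signedSum a ε ^ 2 then 1 else 0) := by
      intro ε
      split_ifs with h
      · nlinarith [sq_nonneg (signedSum a ε ^ 2 - 4 * V)]
      · nlinarith [sq_nonneg (signedSum a ε ^ 2)]
    have h1 := Finset.sum_le_sum (fun ε (_ : ε ∈ (Finset.univ : Finset (Fin n → Bool))) => key ε)
    simp only [Finset.sum_sub_distrib, ← Finset.mul_sum, sum_signedSum_sq, Finset.sum_const,
      Finset.card_univ, Fintype.card_fun, Fintype.card_bool, Fintype.card_fin, nsmul_eq_mul,
      Finset.sum_boole] at h1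
    push_cast at h1
    have h2 := sum_signedSum_pow_four_le a
    rw [← hV] at h1 h2
    have h3 : 3 * V ^ 2 * 2 ^ n ≤ 14 * V ^ 2 *
        ((Finset.univ.filter fun ε => V ≤ 4 * signedSum a ε ^ 2).card : ℝ) := by
      nlinarith
    have h4 : 0 < V ^ 2 := by positivity
    have h5 : V ^ 2 * (3 * 2 ^ n) ≤ V ^ 2 * (14 *
        ((Finset.univ.filter fun ε => V ≤ 4 * signedSum a ε ^ 2).card : ℝ)) := by
      linarith
    have := le_of_mul_le_mul_left h5 h4
    linarith

/-! ### The modular and the Luxemburg quasi-norm. -/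

namespace OrliczFunction

variable {Ω : Type*} [MeasurableSpace Ω] {φ : OrliczFunction} {μ : Measure Ω}

theorem modular_smul_eq {f : Ω →ₘ[μ] ℝ} {g : Ω → ℝ} (h : f =ᵐ[μ] g) (c : ℝ) :
    φ.modular μ (c • f) = ∫⁻ t, (φ (‖c‖₊ * ‖g t‖₊) : ℝ≥0∞) ∂μ := by
  refine lintegral_congr_ae ?_
  filter_upwards [AEEqFun.coeFn_smul c f, h] with t h1 h2
  rw [h1, Pi.smul_apply, h2, nnnorm_smul]

theorem modular_inv_smul_eq {f : Ω →ₘ[μ] ℝ} {g : Ω → ℝ} (h : f =ᵐ[μ] g) (s : ℝ≥0) :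
    φ.modular μ ((s : ℝ)⁻¹ • f) = ∫⁻ t, (φ (s⁻¹ * ‖g t‖₊) : ℝ≥0∞) ∂μ := by
  rw [modular_smul_eq h, nnnorm_inv, NNReal.nnnorm_eq]

theorem modular_smul_mono (f : Ω →ₘ[μ] ℝ) {c d : ℝ} (h : |c| ≤ |d|) :
    φ.modular μ (c • f) ≤ φ.modular μ (d • f) := by
  rw [modular_smul_eq (ae_eq_refl _), modular_smul_eq (ae_eq_refl _)]
  refine lintegral_mono fun t => ?_
  have h' : ‖c‖₊ ≤ ‖d‖₊ := by exact_mod_cast h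
  exact ENNReal.coe_le_coe.2 (φ.strictMono.monotone (mul_le_mul_left h' _))

theorem luxemburg_nonneg (f : φ.space μ) : 0 ≤ φ.luxemburg μ f :=
  Real.sInf_nonneg fun _ h => h.1.le

theorem luxemburg_le {f : φ.space μ} {s : ℝ≥0} (hs : 0 < s) {g : Ω → ℝ}
    (h : (f : Ω →ₘ[μ] ℝ) =ᵐ[μ] g) (hI : ∫⁻ t, (φ (s⁻¹ * ‖g t‖₊) : ℝ≥0∞) ∂μ ≤ 1) :
    φ.luxemburg μ f ≤ s :=
  csInf_le ⟨0, fun _ h => h.1.le⟩ ⟨hs, by rwa [modular_inv_smul_eq h]⟩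

/-- The set in the Luxemburg infimum is nonempty, so the infimum is not a default value: the modular
of `l f / (n + 1)` tends to 0 by dominated convergence. -/
theorem exists_modular_le_one (f : φ.space μ) :
    ∃ ε : ℝ, 0 < ε ∧ φ.modular μ (ε⁻¹ • (f : Ω →ₘ[μ] ℝ)) ≤ 1 := by
  obtain ⟨l, hl, hf⟩ := f.2
  have key : Tendsto (fun n : ℕ => φ.modular μ ((((n : ℝ) + 1) / l)⁻¹ • (f : Ω →ₘ[μ] ℝ))) atTop
      (𝓝 (∫⁻ _, 0 ∂μ)) := by
    have e : ∀ n : ℕ, φ.modular μ ((((n : ℝ) + 1) / l)⁻¹ • (f : Ω →ₘ[μ] ℝ)) =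
        ∫⁻ t, (φ (‖(((n : ℝ) + 1) / l)⁻¹‖₊ * ‖(f : Ω →ₘ[μ] ℝ) t‖₊) : ℝ≥0∞) ∂μ :=
      fun n => modular_smul_eq (ae_eq_refl _) _
    simp only [e]
    refine tendsto_lintegral_of_dominated_convergence
      (fun t => (φ (‖l‖₊ * ‖(f : Ω →ₘ[μ] ℝ) t‖₊) : ℝ≥0∞)) (fun n => ?_) (fun n => ?_) ?_ ?_
    · have hm : Measurable (fun t => ‖(f : Ω →ₘ[μ] ℝ) t‖₊) :=
        (f : Ω →ₘ[μ] ℝ).stronglyMeasurable.measurable.nnnorm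
      exact (φ.continuous.measurable.comp (hm.const_mul _)).coe_nnreal_ennreal
    · refine Eventually.of_forall fun t => ?_
      have h : ‖(((n : ℝ) + 1) / l)⁻¹‖₊ ≤ ‖l‖₊ := by
        rw [← NNReal.coe_le_coe, coe_nnnorm, coe_nnnorm, inv_div, norm_div]
        refine div_le_self (norm_nonneg _) ?_
        rw [Real.norm_of_nonneg (by positivity)]
        linarith [(n.cast_nonneg : (0 : ℝ) ≤ n)]
      exact ENNReal.coe_le_coe.2 (φ.strictMono.monotone (mul_le_mul_left h _))
    · rw [← modular_smul_eq (ae_eq_refl _)]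
      exact hf.ne
    · refine Eventually.of_forall fun t => ?_
      have h1 : Tendsto (fun n : ℕ => (((n : ℝ) + 1) / l)⁻¹) atTop (𝓝 0) := by
        refine tendsto_inv_atTop_zero.comp ((tendsto_natCast_atTop_atTop.atTop_add
          (tendsto_const_nhds (x := (1 : ℝ)))).atTop_div_const hl)
      have h2 : Tendsto (fun n : ℕ => ‖(((n : ℝ) + 1) / l)⁻¹‖₊ * ‖(f : Ω →ₘ[μ] ℝ) t‖₊) atTop
          (𝓝 0) := by
        simpa using h1.nnnorm.mul_const ‖(f : Ω →ₘ[μ] ℝ) t‖₊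
      have h3 := (φ.continuous.tendsto 0).comp h2
      rw [φ.map_zero] at h3
      exact ENNReal.tendsto_coe.2 h3
  rw [lintegral_zero] at key
  obtain ⟨n, hn⟩ := (key.eventually (Iio_mem_nhds one_pos)).exists
  exact ⟨((n : ℝ) + 1) / l, by positivity, le_of_lt hn⟩

/-- Only scales strictly above the quasi-norm are used, so it never matters whether the infimum is
attained. -/
theorem modular_le_one_of_lt {f : φ.space μ} {s : ℝ≥0} (hs : φ.luxemburg μ f < s) {g : Ω → ℝ}
    (h : (f : Ω →ₘ[μ] ℝ) =ᵐ[μ] g) : ∫⁻ t, (φ (s⁻¹ * ‖g t‖₊) : ℝ≥0∞) ∂μ ≤ 1 := by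
  obtain ⟨ε, ⟨h0, hI⟩, hε⟩ := exists_lt_of_csInf_lt (exists_modular_le_one f) hs
  rw [← modular_inv_smul_eq h]
  refine (modular_smul_mono _ ?_).trans hI
  rw [abs_of_nonneg (by positivity), abs_of_nonneg (by positivity)]
  exact inv_anti₀ h0 hε.le

theorem luxemburg_smul (c : ℝ) (f : φ.space μ) :
    φ.luxemburg μ (c • f) = |c| * φ.luxemburg μ f := by
  rcases eq_or_ne c 0 with rfl | hc
  · rw [zero_smul, abs_zero, zero_mul]
    refine le_antisymm (le_of_forall_pos_le_add fun ε hε => ?_) (luxemburg_nonneg _)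
    lift ε to ℝ≥0 using hε.le
    rw [zero_add]
    refine luxemburg_le (by exact_mod_cast hε) (g := fun _ => 0) ?_ (by simp [φ.map_zero])
    exact AEEqFun.coeFn_zero
  · unfold luxemburg
    rw [← smul_eq_mul, ← Real.sInf_smul_of_nonneg (abs_nonneg c)]
    congr 1
    ext ε
    have hc' : 0 < |c| := abs_pos.2 hc
    rw [Set.mem_smul_set_iff_inv_smul_mem₀ hc'.ne']
    simp only [Set.mem_ofPred_eq, smul_eq_mul, Submodule.coe_smul, smul_smul]
    refine and_congr (by rw [mul_pos_iff_of_pos_left (inv_pos.2 hc')]) ?_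
    have h : φ.modular μ ((ε⁻¹ * c) • (f : Ω →ₘ[μ] ℝ)) =
        φ.modular μ ((|c|⁻¹ * ε)⁻¹ • (f : Ω →ₘ[μ] ℝ)) := by
      refine le_antisymm (modular_smul_mono _ ?_) (modular_smul_mono _ ?_) <;>
      simp [abs_mul, mul_comm]
    rw [h]

/-- The element of `L_φ` given by a measurable function with finite modular. -/
noncomputable def spaceMk (φ : OrliczFunction) (μ : Measure Ω) (g : Ω → ℝ) (hg : Measurable g)
    (h : ∫⁻ t, (φ ‖g t‖₊ : ℝ≥0∞) ∂μ < ∞) : φ.space μ :=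
  ⟨AEEqFun.mk g hg.aestronglyMeasurable, 1, one_pos, by
    rw [modular_smul_eq (AEEqFun.coeFn_mk g hg.aestronglyMeasurable)]
    simpa using h⟩

theorem coeFn_spaceMk {g : Ω → ℝ} (hg : Measurable g)
    (h : ∫⁻ t, (φ ‖g t‖₊ : ℝ≥0∞) ∂μ < ∞) :
    ((spaceMk φ μ g hg h : φ.space μ) : Ω →ₘ[μ] ℝ) =ᵐ[μ] g :=
  AEEqFun.coeFn_mk g hg.aestronglyMeasurable

theorem coeFn_signedSum {n : ℕ} (x : Fin n → φ.space μ) {g : Fin n → Ω → ℝ}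
    (h : ∀ k, (x k : Ω →ₘ[μ] ℝ) =ᵐ[μ] g k) (ε : Fin n → Bool) :
    ((∑ k, boolSign (ε k) • x k : φ.space μ) : Ω →ₘ[μ] ℝ) =ᵐ[μ]
      fun t => signedSum (fun k => g k t) ε := by
  have key : ∀ s : Finset (Fin n), ((∑ k ∈ s, boolSign (ε k) • x k : φ.space μ) : Ω →ₘ[μ] ℝ) =ᵐ[μ]
      fun t => ∑ k ∈ s, boolSign (ε k) * g k t := by
    intro s
    induction s using Finset.induction_on with
    | empty =>
      simp only [Finset.sum_empty]
      exact AEEqFun.coeFn_zero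
    | insert a s ha ih =>
      simp only [Finset.sum_insert ha, Submodule.coe_add, Submodule.coe_smul]
      filter_upwards [AEEqFun.coeFn_add (boolSign (ε a) • (x a : Ω →ₘ[μ] ℝ))
        ((∑ k ∈ s, boolSign (ε k) • x k : φ.space μ) : Ω →ₘ[μ] ℝ),
        AEEqFun.coeFn_smul (boolSign (ε a)) (x a : Ω →ₘ[μ] ℝ), h a, ih] with t h1 h2 h3 h4
      rw [h1, Pi.add_apply, h2, Pi.smul_apply, h3, h4, smul_eq_mul]
  exact key Finset.univ

end OrliczFunction

/-! ### The `ℓ_p` quasi-norms of finite families. -/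

/-- The `ℓ_p` quasi-norm of a finite family. -/
noncomputable def ellNorm (p : ℝ) {n : ℕ} (a : Fin n → ℝ≥0) : ℝ≥0 :=
  (∑ k, a k ^ p) ^ p⁻¹

theorem ellNorm_rpow {p : ℝ} (hp : 0 < p) {n : ℕ} (a : Fin n → ℝ≥0) :
    ellNorm p a ^ p = ∑ k, a k ^ p :=
  NNReal.rpow_inv_rpow hp.ne' _

theorem ellNorm_le_iff {p : ℝ} (hp : 0 < p) {n : ℕ} {a : Fin n → ℝ≥0} {b : ℝ≥0} :
    ellNorm p a ≤ b ↔ ∑ k, a k ^ p ≤ b ^ p :=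
  NNReal.rpow_inv_le_iff hp

theorem ellNorm_mul {p : ℝ} (hp : 0 < p) {n : ℕ} (c : ℝ≥0) (a : Fin n → ℝ≥0) :
    ellNorm p (fun k => c * a k) = c * ellNorm p a := by
  unfold ellNorm
  simp only [NNReal.mul_rpow, ← Finset.mul_sum]
  rw [NNReal.rpow_rpow_inv hp.ne']

theorem ellNorm_mono {p : ℝ} (hp : 0 < p) {n : ℕ} {a b : Fin n → ℝ≥0} (h : ∀ k, a k ≤ b k) :
    ellNorm p a ≤ ellNorm p b := by
  rw [ellNorm_le_iff hp, ellNorm_rpow hp]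
  exact Finset.sum_le_sum fun k _ => NNReal.rpow_le_rpow (h k) hp.le

theorem le_ellNorm {p : ℝ} (hp : 0 < p) {n : ℕ} (a : Fin n → ℝ≥0) (k : Fin n) :
    a k ≤ ellNorm p a := by
  rw [← NNReal.rpow_le_rpow_iff hp, ellNorm_rpow hp]
  exact Finset.single_le_sum (f := fun k => a k ^ p) (fun _ _ => zero_le) (Finset.mem_univ k)

theorem ellNorm_pos {p : ℝ} (hp : 0 < p) {n : ℕ} {a : Fin n → ℝ≥0} (h : ∃ k, 0 < a k) :
    0 < ellNorm p a :=
  h.elim fun k hk => hk.trans_le (le_ellNorm hp a k)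

theorem ellNorm_one {n : ℕ} (a : Fin n → ℝ≥0) : ellNorm 1 a = ∑ k, a k := by
  simp [ellNorm]

theorem NNReal.sum_rpow_le_rpow_sum {ι : Type*} (s : Finset ι) (w : ι → ℝ≥0) {r : ℝ}
    (hr : 1 ≤ r) : ∑ k ∈ s, w k ^ r ≤ (∑ k ∈ s, w k) ^ r := by
  classical
  induction s using Finset.induction_on with
  | empty => simp
  | insert a s ha ih =>
    rw [Finset.sum_insert ha, Finset.sum_insert ha]
    exact (add_le_add_right ih _).trans (NNReal.add_rpow_le_rpow_add _ _ hr)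

theorem ellNorm_anti {p q : ℝ} (hp : 0 < p) (hpq : p ≤ q) {n : ℕ} (a : Fin n → ℝ≥0) :
    ellNorm q a ≤ ellNorm p a := by
  have hq : 0 < q := hp.trans_le hpq
  rw [ellNorm_le_iff hq]
  have h := NNReal.sum_rpow_le_rpow_sum Finset.univ (fun k => a k ^ p) ((one_le_div hp).2 hpq)
  rw [← ellNorm_rpow hp] at h
  simp only [← NNReal.rpow_mul, mul_div_cancel₀ q hp.ne'] at h
  exact h

theorem nnnorm_signedSum_le {n : ℕ} (a : Fin n → ℝ) (ε : Fin n → Bool) :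
    ‖signedSum a ε‖₊ ≤ ellNorm 1 (fun k => ‖a k‖₊) := by
  rw [ellNorm_one]
  refine (nnnorm_sum_le _ _).trans (Finset.sum_le_sum fun k _ => ?_)
  rw [nnnorm_mul, nnnorm_boolSign, one_mul]

theorem measurable_signedSum {Ω : Type*} [MeasurableSpace Ω] {n : ℕ} {g : Fin n → Ω → ℝ}
    (h : ∀ k, Measurable (g k)) (ε : Fin n → Bool) :
    Measurable fun t => signedSum (fun k => g k t) ε := by
  unfold signedSum
  exact Finset.measurable_fun_sum _ fun k _ => (h k).const_mul _

theorem coe_ellNorm_two_sq {n : ℕ} (a : Fin n → ℝ) :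
    ((ellNorm 2 fun k => ‖a k‖₊ : ℝ≥0) : ℝ) ^ 2 = ∑ k, a k ^ 2 := by
  have h := congrArg (fun x : ℝ≥0 => (x : ℝ)) (ellNorm_rpow two_pos fun k => ‖a k‖₊)
  simpa using h

theorem card_ellNorm_two_le {n : ℕ} (a : Fin n → ℝ) :
    (2 ^ n : ℝ) * (3 / 14) ≤
      ((Finset.univ.filter fun ε => ellNorm 2 (fun k => ‖a k‖₊) ≤ 2 * ‖signedSum a ε‖₊).card :
        ℝ) := by
  refine (card_signedSum_ge a).trans (Nat.cast_le.2 (Finset.card_le_card fun ε => ?_))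
  simp only [Finset.mem_filter, Finset.mem_univ, true_and]
  intro h
  rw [← coe_ellNorm_two_sq] at h
  rw [← NNReal.coe_le_coe]
  refine le_of_sq_le_sq (h.trans (le_of_eq ?_)) (by positivity)
  simp [mul_pow]
  norm_num

/-! ### Growth conditions, weak Jensen inequalities and Khintchine's inequality. -/

/-- The growth condition `c a ^ p ψ u ≤ ψ (a u)` for all `a ≥ 1` and all `u`. -/
def LowerGrowth (ψ : ℝ≥0 → ℝ≥0) (p : ℝ) (c : ℝ≥0) : Prop :=
  ∀ a u : ℝ≥0, 1 ≤ a → c * a ^ p * ψ u ≤ ψ (a * u)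

/-- The growth condition `ψ (a u) ≤ C a ^ q ψ u` for all `a ≥ 1` and all `u`. -/
def UpperGrowth (ψ : ℝ≥0 → ℝ≥0) (q : ℝ) (C : ℝ≥0) : Prop :=
  ∀ a u : ℝ≥0, 1 ≤ a → ψ (a * u) ≤ C * a ^ q * ψ u

theorem LowerGrowth.inv_mul_le {ψ : ℝ≥0 → ℝ≥0} {p : ℝ} {c : ℝ≥0} (h : LowerGrowth ψ p c)
    (hc : 0 < c) {a : ℝ≥0} (ha : 1 ≤ a) (u : ℝ≥0) : ψ (a⁻¹ * u) ≤ (c * a ^ p)⁻¹ * ψ u := by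
  have ha0 : 0 < a := one_pos.trans_le ha
  have h1 := h a (a⁻¹ * u) ha
  rw [mul_inv_cancel_left₀ ha0.ne'] at h1
  rwa [le_inv_mul_iff₀ (mul_pos hc (NNReal.rpow_pos ha0))]

/-- Growth faster than `u ^ p` gives a weak form of Jensen's inequality for `u ↦ ψ (u ^ (1 / p))`. -/
theorem LowerGrowth.ellNorm_le {ψ : ℝ≥0 → ℝ≥0} {p : ℝ} {c : ℝ≥0} (h : LowerGrowth ψ p c)
    (hψ : Monotone ψ) (hp : 0 < p) {n : ℕ} (l z : Fin n → ℝ≥0) (hl : ∑ k, l k ^ p = 1) :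
    c * ψ ((2 : ℝ≥0)⁻¹ ^ p⁻¹ * ellNorm p (fun k => l k * z k)) ≤ ∑ k, l k ^ p * ψ (z k) := by
  set w := (2 : ℝ≥0)⁻¹ ^ p⁻¹ * ellNorm p (fun k => l k * z k) with hw
  -- The factor 2 makes the weighted mean of `(z_k / w) ^ p` equal to 2, so that one copy of `c
  -- ψ(w)` survives after the additive error `c ψ(w)` in `key` has been cancelled.
  have hwp : 2 * w ^ p = ∑ k, l k ^ p * z k ^ p := by
    rw [hw, NNReal.mul_rpow, NNReal.rpow_inv_rpow hp.ne', ellNorm_rpow hp,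
      mul_inv_cancel_left₀ two_ne_zero]
    simp only [NNReal.mul_rpow]
  rcases eq_or_ne w 0 with h0 | h0
  · have h1 : c * ψ w ≤ ψ w := by simpa using h 1 w le_rfl
    refine h1.trans ?_
    calc ψ w = ∑ k, l k ^ p * ψ w := by rw [← Finset.sum_mul, hl, one_mul]
      _ ≤ _ := Finset.sum_le_sum fun k _ =>
        mul_le_mul_right (hψ (by rw [h0]; exact zero_le)) _
  · have h0' : 0 < w := pos_iff_ne_zero.2 h0
    have hwp0 : 0 < w ^ p := NNReal.rpow_pos h0'
    have key : ∀ z : ℝ≥0, c * ψ w * z ^ p ≤ w ^ p * (ψ z + c * ψ w) := by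
      intro z
      rcases le_total z w with hz | hz
      · calc c * ψ w * z ^ p ≤ c * ψ w * w ^ p := by gcongr
          _ ≤ _ := by rw [mul_add, mul_comm (c * ψ w)]; exact le_add_self
      · have h2 := h (z / w) w ((one_le_div h0').2 hz)
        rw [div_mul_cancel₀ _ h0, NNReal.div_rpow] at h2
        calc c * ψ w * z ^ p = w ^ p * (c * (z ^ p / w ^ p) * ψ w) := by
              field_simp
          _ ≤ w ^ p * ψ z := by gcongr
          _ ≤ _ := by gcongr; exact le_self_add
    have h3 : c * ψ w * (2 * w ^ p) ≤ w ^ p * (∑ k, l k ^ p * ψ (z k) + c * ψ w) := by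
      calc c * ψ w * (2 * w ^ p) = ∑ k, l k ^ p * (c * ψ w * z k ^ p) := by
            rw [hwp, Finset.mul_sum]
            exact Finset.sum_congr rfl fun k _ => by ring
        _ ≤ ∑ k, l k ^ p * (w ^ p * (ψ (z k) + c * ψ w)) := by
            exact Finset.sum_le_sum fun k _ => mul_le_mul_right (key _) _
        _ = w ^ p * (∑ k, l k ^ p * ψ (z k) + (∑ k, l k ^ p) * (c * ψ w)) := by
            rw [Finset.sum_mul, ← Finset.sum_add_distrib, Finset.mul_sum]
            exact Finset.sum_congr rfl fun k _ => by ring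
        _ = _ := by rw [hl, one_mul]
    have h4 : w ^ p * (c * ψ w + c * ψ w) ≤ w ^ p * (∑ k, l k ^ p * ψ (z k) + c * ψ w) := by
      refine le_trans (le_of_eq ?_) h3
      ring
    exact le_of_add_le_add_right (le_of_mul_le_mul_left h4 hwp0)

/-- Growth slower than `u ^ s` gives a weak form of the reverse Jensen inequality for
`u ↦ ψ (u ^ (1 / s))`. -/
theorem UpperGrowth.le_ellNorm {ψ : ℝ≥0 → ℝ≥0} {s : ℝ} {C : ℝ≥0} (h : UpperGrowth ψ s C)
    (hψ : Monotone ψ) (hs : 0 < s) {n : ℕ} (l z : Fin n → ℝ≥0) (hl : ∑ k, l k ^ s = 1) :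
    ∑ k, l k ^ s * ψ (z k) ≤ (C + 1) * ψ (ellNorm s (fun k => l k * z k)) := by
  set w := ellNorm s (fun k => l k * z k) with hw
  have hws : w ^ s = ∑ k, l k ^ s * z k ^ s := by
    rw [hw, ellNorm_rpow hs]
    simp only [NNReal.mul_rpow]
  rcases eq_or_ne w 0 with h0 | h0
  · have h1 : ∀ k, l k ^ s * ψ (z k) ≤ l k ^ s * ψ w := by
      intro k
      have h2 : l k * z k ≤ w := _root_.le_ellNorm hs (fun k => l k * z k) k
      rw [h0, le_zero_iff, mul_eq_zero] at h2
      rcases h2 with h2 | h2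
      · rw [h2, NNReal.zero_rpow hs.ne', zero_mul, zero_mul]
      · rw [h2, h0]
    calc _ ≤ ∑ k, l k ^ s * ψ w := Finset.sum_le_sum fun k _ => h1 k
      _ = ψ w := by rw [← Finset.sum_mul, hl, one_mul]
      _ ≤ _ := by rw [add_mul, one_mul]; exact le_add_self
  · have h0' : 0 < w := pos_iff_ne_zero.2 h0
    have hws0 : w ^ s ≠ 0 := (NNReal.rpow_pos h0').ne'
    -- A majorant valid on both sides of `w`: monotonicity for `z ≤ w`, growth for `z ≥ w`. The
    -- weighted mean of `(z_k / w) ^ s` is 1, which gives the constant `C + 1`.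
    have key : ∀ z : ℝ≥0, ψ z ≤ C * ψ w * (z ^ s / w ^ s) + ψ w := by
      intro z
      rcases le_total z w with hz | hz
      · exact (hψ hz).trans le_add_self
      · have h2 := h (z / w) w ((one_le_div h0').2 hz)
        rw [div_mul_cancel₀ _ h0, NNReal.div_rpow] at h2
        refine h2.trans ((le_of_eq ?_).trans le_self_add)
        ring
    calc ∑ k, l k ^ s * ψ (z k) ≤ ∑ k, l k ^ s * (C * ψ w * (z k ^ s / w ^ s) + ψ w) := by
          gcongr with k; exact key _
      _ = C * ψ w * ((∑ k, l k ^ s * z k ^ s) / w ^ s) + (∑ k, l k ^ s) * ψ w := by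
          rw [Finset.sum_mul, Finset.sum_div, Finset.mul_sum, ← Finset.sum_add_distrib]
          exact Finset.sum_congr rfl fun k _ => by ring
      _ = _ := by rw [← hws, div_self hws0, hl]; ring

theorem exists_rpow_le_mul_exp (q : ℝ) : ∃ A : ℝ, 0 < A ∧ ∀ x : ℝ, 1 ≤ x →
    x ^ q ≤ A * Real.exp x := by
  obtain ⟨N, hN⟩ := exists_nat_ge q
  refine ⟨N.factorial, by positivity, fun x hx => ?_⟩
  have h := Real.pow_div_factorial_le_exp x (by linarith) N
  rw [div_le_iff₀' (by positivity)] at h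
  refine le_trans ?_ h
  rw [← Real.rpow_natCast]
  exact Real.rpow_le_rpow_of_exponent_le hx hN

/-- Khintchine's inequality (the upper estimate) for functions of at most polynomial growth. -/
theorem UpperGrowth.exists_khintchine {ψ : ℝ≥0 → ℝ≥0} {q : ℝ} {C : ℝ≥0} (h : UpperGrowth ψ q C)
    (hψ : Monotone ψ) : ∃ D : ℝ≥0, ∀ (n : ℕ) (a : Fin n → ℝ),
      ∑ ε, ψ ‖signedSum a ε‖₊ ≤ 2 ^ n * (D * ψ (ellNorm 2 fun k => ‖a k‖₊)) := by
  obtain ⟨A, hA, hexp⟩ := exists_rpow_le_mul_exp q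
  lift A to ℝ≥0 using hA.le
  -- Where the signed sum is at most `w`, monotonicity suffices and costs the 1. Elsewhere growth
  -- and `x ^ q ≤ A exp x` apply to the ratio to `w`, and the mean of `exp |S / w|` is at most `2
  -- exp (1 / 2)`.
  refine ⟨1 + C * (A * (2 * (Real.exp (1 / 2)).toNNReal)), fun n a => ?_⟩
  set w := ellNorm 2 fun k => ‖a k‖₊ with hw
  rcases eq_or_ne w 0 with h0 | h0
  · have h1 : ∀ k, a k = 0 := by
      intro k
      have := _root_.le_ellNorm two_pos (fun k => ‖a k‖₊) k
      rw [← hw, h0, le_zero_iff, nnnorm_eq_zero] at this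
      exact this
    have h2 : ∀ ε, ‖signedSum a ε‖₊ = w := by
      intro ε; simp [signedSum, h1, h0]
    simp only [h2, Finset.sum_const, Finset.card_univ, Fintype.card_fun, Fintype.card_bool,
      Fintype.card_fin, nsmul_eq_mul]
    push_cast
    gcongr
    rw [add_mul, one_mul]
    exact le_self_add
  · have h0' : 0 < w := pos_iff_ne_zero.2 h0
    have hsum : ∑ k, (a k / w) ^ 2 = 1 := by
      simp only [div_pow, ← Finset.sum_div]
      rw [← coe_ellNorm_two_sq, ← hw, div_self (by positivity)]
    have hS : ∀ ε, signedSum (fun k => a k / w) ε = signedSum a ε / w := by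
      intro ε
      simp only [signedSum, Finset.sum_div, mul_div_assoc]
    have he := sum_exp_abs_signedSum_le (fun k => a k / (w : ℝ))
    rw [hsum] at he
    simp only [hS] at he
    have he' : ∑ ε, (Real.exp |signedSum a ε / w|).toNNReal ≤
        2 ^ n * (2 * (Real.exp (1 / 2)).toNNReal) := by
      rw [← NNReal.coe_le_coe]
      push_cast
      simpa only [Real.coe_toNNReal _ (Real.exp_pos _).le] using he
    have key : ∀ ε, ψ ‖signedSum a ε‖₊ ≤
        ψ w + C * A * (Real.exp |signedSum a ε / w|).toNNReal * ψ w := by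
      intro ε
      rcases le_total ‖signedSum a ε‖₊ w with hz | hz
      · exact (hψ hz).trans le_self_add
      · have h1 : 1 ≤ ‖signedSum a ε‖₊ / w := (one_le_div h0').2 hz
        have h2 := h _ w h1
        rw [div_mul_cancel₀ _ h0] at h2
        refine h2.trans (le_trans ?_ le_add_self)
        rw [mul_assoc C A]
        gcongr
        rw [← NNReal.coe_le_coe]
        push_cast
        have h3 := hexp (‖signedSum a ε‖₊ / w) (by exact_mod_cast h1)
        simpa [abs_div, Real.coe_toNNReal _ (Real.exp_pos _).le] using h3
    calc _ ≤ ∑ ε, (ψ w + C * A * (Real.exp |signedSum a ε / w|).toNNReal * ψ w) :=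
          Finset.sum_le_sum fun ε _ => key ε
      _ = 2 ^ n * ψ w + C * A *
          (∑ ε, (Real.exp |signedSum a ε / w|).toNNReal) * ψ w := by
          rw [Finset.sum_add_distrib, Finset.mul_sum, Finset.sum_mul]
          simp
      _ ≤ 2 ^ n * ψ w + C * A * (2 ^ n * (2 * (Real.exp (1 / 2)).toNNReal)) * ψ w := by
          gcongr
      _ = _ := by ring

/-! ### Type and cotype from growth conditions on all arguments. -/

namespace OrliczFunction

variable {Ω : Type*} [MeasurableSpace Ω] {φ : OrliczFunction} {μ : Measure Ω} {ψ : ℝ≥0 → ℝ≥0}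

/-- The modulars of `φ` and of the monotone function `ψ` define the same bounded sets. -/
structure ModularComparison (φ : OrliczFunction) (μ : Measure Ω) (ψ : ℝ≥0 → ℝ≥0) : Prop where
  mono : Monotone ψ
  bound : ∃ B : ℝ≥0, ∀ g : Ω → ℝ≥0, Measurable g →
    ∫⁻ t, (φ (g t) : ℝ≥0∞) ∂μ ≤ 1 → ∫⁻ t, (ψ (g t) : ℝ≥0∞) ∂μ ≤ B
  small : ∃ b : ℝ≥0, 0 < b ∧ ∀ g : Ω → ℝ≥0, Measurable g →
    ∫⁻ t, (ψ (g t) : ℝ≥0∞) ∂μ ≤ b → ∫⁻ t, (φ (g t) : ℝ≥0∞) ∂μ ≤ 1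

theorem exists_measurable_ae_eq (f : φ.space μ) :
    ∃ g : Ω → ℝ, Measurable g ∧ (f : Ω →ₘ[μ] ℝ) =ᵐ[μ] g :=
  ⟨_, (f : Ω →ₘ[μ] ℝ).stronglyMeasurable.measurable, ae_eq_refl _⟩

theorem lintegral_mono_of_forall_le {f g : Ω → ℝ≥0∞} (h : ∀ t, f t ≤ g t) :
    ∫⁻ t, f t ∂μ ≤ ∫⁻ t, g t ∂μ :=
  lintegral_mono h

theorem lintegral_comp_mul_le {c d : ℝ≥0} (h : ∀ u, ψ (d * u) ≤ c * ψ u) (g : Ω → ℝ≥0) :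
    ∫⁻ t, (ψ (d * g t) : ℝ≥0∞) ∂μ ≤ c * ∫⁻ t, (ψ (g t) : ℝ≥0∞) ∂μ := by
  rw [← lintegral_const_mul' _ _ ENNReal.coe_ne_top]
  exact lintegral_mono_of_forall_le fun t => by exact_mod_cast h (g t)

theorem _root_.LowerGrowth.lintegral_le {p : ℝ} {c : ℝ≥0} (h : LowerGrowth ψ p c) (hc : 0 < c)
    {a : ℝ≥0} (ha : 1 ≤ a) (g : Ω → ℝ≥0) :
    ∫⁻ t, (ψ (a⁻¹ * g t) : ℝ≥0∞) ∂μ ≤ ((c * a ^ p : ℝ≥0) : ℝ≥0∞)⁻¹ * ∫⁻ t, (ψ (g t) : ℝ≥0∞) ∂μ := by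
  have := lintegral_comp_mul_le (μ := μ) (fun u => h.inv_mul_le hc ha u) g
  rwa [ENNReal.coe_inv (mul_pos hc (NNReal.rpow_pos (one_pos.trans_le ha))).ne'] at this

/-- Dividing by `D` shrinks the modular by the factor `(c D ^ p)⁻¹`, which tends to 0 because the
exponent is positive. This converts bounded modulars into bounds for the quasi-norm. -/
theorem _root_.LowerGrowth.exists_scale {p : ℝ} {c : ℝ≥0} (h : LowerGrowth ψ p c) (hc : 0 < c)
    (hp : 0 < p) (M : ℝ≥0) {b : ℝ≥0} (hb : 0 < b) : ∃ D : ℝ≥0, 1 ≤ D ∧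
      ∀ g : Ω → ℝ≥0, ∫⁻ t, (ψ (g t) : ℝ≥0∞) ∂μ ≤ M → ∫⁻ t, (ψ (D⁻¹ * g t) : ℝ≥0∞) ∂μ ≤ b := by
  have ht : Tendsto (fun a : ℝ≥0 => c * a ^ p) atTop atTop :=
    (NNReal.tendsto_rpow_atTop hp).const_mul_atTop hc
  obtain ⟨D, h1, hD⟩ := ((eventually_ge_atTop 1).and (ht.eventually_ge_atTop (M / b))).exists
  refine ⟨D, h1, fun g hg => ?_⟩
  have hpos : 0 < c * D ^ p := mul_pos hc (NNReal.rpow_pos (one_pos.trans_le h1))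
  refine (h.lintegral_le hc h1 g).trans ?_
  rw [div_le_iff₀ hb] at hD
  calc _ ≤ ((c * D ^ p : ℝ≥0) : ℝ≥0∞)⁻¹ * M := by gcongr
    _ = (((c * D ^ p)⁻¹ * M : ℝ≥0) : ℝ≥0∞) := by
      rw [ENNReal.coe_mul _ M, ENNReal.coe_inv hpos.ne']
    _ ≤ b := by
      refine ENNReal.coe_le_coe.2 ?_
      rwa [inv_mul_le_iff₀ hpos]

/-- Allows the quasi-norms to be replaced by strict upper bounds, for which the modular is known to
be at most 1. -/
theorem le_of_forall_pos_ellNorm {p : ℝ} (hp : 0 < p) {n : ℕ} {a : Fin n → ℝ}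
    {A K : ℝ} (h : ∀ δ : ℝ, 0 < δ → A ≤ K * (∑ k, (a k + δ) ^ p) ^ (1 / p)) :
    A ≤ K * (∑ k, a k ^ p) ^ (1 / p) := by
  have hc : Continuous fun δ : ℝ => K * (∑ k, (a k + δ) ^ p) ^ (1 / p) := by
    refine continuous_const.mul (Continuous.rpow_const ?_ fun _ => Or.inr (by positivity))
    exact continuous_finsetSum _ fun k _ =>
      (continuous_const.add continuous_id).rpow_const fun _ => Or.inr hp.le
  have ht := (hc.tendsto 0).mono_left (nhdsWithin_le_nhds (s := Set.Ioi 0))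
  simp only [add_zero] at ht
  exact ge_of_tendsto ht (eventually_mem_nhdsWithin.mono fun δ hδ => h δ hδ)

/-- A Luxemburg norm bound for `(∑ |xₖ| ^ p) ^ (1 / p)`. -/
theorem ModularComparison.exists_convexity (hψ : ModularComparison φ μ ψ) {p : ℝ} {c : ℝ≥0}
    (h : LowerGrowth ψ p c) (hc : 0 < c) (hp : 0 < p) : ∃ B : ℝ≥0, ∀ (n : ℕ) (_ : 0 < n)
      (x : Fin n → φ.space μ) (g : Fin n → Ω → ℝ) (_ : ∀ k, Measurable (g k))
      (_ : ∀ k, (x k : Ω →ₘ[μ] ℝ) =ᵐ[μ] g k) (s : Fin n → ℝ≥0)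
      (_ : ∀ k, φ.luxemburg μ (x k) < s k),
      ∫⁻ t, (ψ ((2 ^ p⁻¹ * ellNorm p s)⁻¹ * ellNorm p (fun k => ‖g k t‖₊)) : ℝ≥0∞) ∂μ ≤ B := by
  obtain ⟨B, hB⟩ := hψ.bound
  refine ⟨c⁻¹ * B, fun n hn x g hg hx s hs => ?_⟩
  have hs0 : ∀ k, 0 < s k := fun k => by
    have := (luxemburg_nonneg (x k)).trans_lt (hs k)
    exact_mod_cast this
  set T := ellNorm p s with hT
  have hT0 : 0 < T := ellNorm_pos hp ⟨⟨0, hn⟩, hs0 _⟩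
  have hl : ∑ k, (s k / T) ^ p = 1 := by
    simp only [NNReal.div_rpow, ← Finset.sum_div]
    rw [← ellNorm_rpow hp, ← hT, div_self (NNReal.rpow_pos hT0).ne']
  -- Weak Jensen with weights `(s_k / T) ^ p` at the normalized points `|g_k| / s_k`.
  have key : ∀ t, ψ ((2 ^ p⁻¹ * T)⁻¹ * ellNorm p (fun k => ‖g k t‖₊)) ≤
      c⁻¹ * ∑ k, (s k / T) ^ p * ψ ((s k)⁻¹ * ‖g k t‖₊) := by
    intro t
    rw [le_inv_mul_iff₀ hc]
    refine le_trans (le_of_eq ?_)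
      (h.ellNorm_le hψ.mono hp (fun k => s k / T) (fun k => (s k)⁻¹ * ‖g k t‖₊) hl)
    have e : (fun k => s k / T * ((s k)⁻¹ * ‖g k t‖₊)) = fun k => T⁻¹ * ‖g k t‖₊ := by
      funext k
      have := (hs0 k).ne'
      field_simp
    rw [e, ellNorm_mul hp, NNReal.inv_rpow, mul_inv, mul_assoc]
  have hm : ∀ k, Measurable fun t => (ψ ((s k)⁻¹ * ‖g k t‖₊) : ℝ≥0∞) := fun k =>
    (hψ.mono.measurable.comp ((hg k).nnnorm.const_mul _)).coe_nnreal_ennreal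
  calc _ ≤ ∫⁻ t, (c⁻¹ : ℝ≥0) * ∑ k, (((s k / T) ^ p : ℝ≥0) : ℝ≥0∞) *
        (ψ ((s k)⁻¹ * ‖g k t‖₊) : ℝ≥0∞) ∂μ :=
        lintegral_mono_of_forall_le fun t => by exact_mod_cast key t
    _ = (c⁻¹ : ℝ≥0) * ∑ k, (((s k / T) ^ p : ℝ≥0) : ℝ≥0∞) *
        ∫⁻ t, (ψ ((s k)⁻¹ * ‖g k t‖₊) : ℝ≥0∞) ∂μ := by
        rw [lintegral_const_mul' _ _ ENNReal.coe_ne_top,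
          lintegral_finsetSum _ fun k _ => (hm k).const_mul _]
        congr 1
        exact Finset.sum_congr rfl fun k _ => lintegral_const_mul' _ _ ENNReal.coe_ne_top
    _ ≤ (c⁻¹ : ℝ≥0) * ∑ k, (((s k / T) ^ p : ℝ≥0) : ℝ≥0∞) * B := by
        gcongr with k
        exact hB _ ((hg k).nnnorm.const_mul _) (modular_le_one_of_lt (hs k) (hx k))
    _ = ((c⁻¹ * ((∑ k, (s k / T) ^ p) * B) : ℝ≥0) : ℝ≥0∞) := by
        rw [Finset.sum_mul]; push_cast; rfl
    _ = _ := by rw [hl, one_mul]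

/-- For `p ≤ 1` every signed sum is bounded pointwise by the `ℓ_1`, hence by the `ℓ_p` function. The
bound is uniform in the signs, so neither Khintchine nor upper growth is needed. -/
theorem ModularComparison.hasType_of_le_one (hψ : ModularComparison φ μ ψ) {p : ℝ} {c : ℝ≥0}
    (h : LowerGrowth ψ p c) (hc : 0 < c) (hp : 0 < p) (hp1 : p ≤ 1) :
    HasType (φ.luxemburg μ) p := by
  obtain ⟨B, hB⟩ := hψ.exists_convexity h hc hp
  obtain ⟨b, hb, hsmall⟩ := hψ.small
  obtain ⟨D, hD1, hD⟩ := h.exists_scale (μ := μ) hc hp B hb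
  have hD0 : 0 < D := one_pos.trans_le hD1
  refine ⟨hp, (D * 2 ^ p⁻¹ : ℝ≥0), NNReal.coe_pos.2 (mul_pos hD0 (NNReal.rpow_pos two_pos)),
    fun n x => ?_⟩
  rcases Nat.eq_zero_or_pos n with rfl | hn
  · have h0 : φ.luxemburg μ 0 = 0 := by simpa using luxemburg_smul (0 : ℝ) (0 : φ.space μ)
    refine (rademacherAverage_le (M := 0) fun ε => ?_).trans ?_
    · simp [h0]
    · simp [Real.zero_rpow (inv_ne_zero hp.ne')]
  refine le_of_forall_pos_ellNorm hp fun δ hδ => ?_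
  choose g hg hx using fun k => exists_measurable_ae_eq (x k)
  set s : Fin n → ℝ≥0 := fun k => (φ.luxemburg μ (x k) + δ).toNNReal with hs
  have hsc : ∀ k, (s k : ℝ) = φ.luxemburg μ (x k) + δ := fun k =>
    Real.coe_toNNReal _ (add_nonneg (luxemburg_nonneg _) hδ.le)
  have hlt : ∀ k, φ.luxemburg μ (x k) < s k := fun k => by rw [hsc]; linarith
  have hI := hB n hn x g hg hx s hlt
  have hT0 : 0 < ellNorm p s := ellNorm_pos hp ⟨⟨0, hn⟩, by
    have := (luxemburg_nonneg (x ⟨0, hn⟩)).trans_lt (hlt ⟨0, hn⟩)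
    exact_mod_cast this⟩
  have hU0 : 0 < 2 ^ p⁻¹ * ellNorm p s := mul_pos (NNReal.rpow_pos two_pos) hT0
  have hfin : ((D * 2 ^ p⁻¹ : ℝ≥0) : ℝ) * (∑ k, (φ.luxemburg μ (x k) + δ) ^ p) ^ (1 / p) =
      ((D * (2 ^ p⁻¹ * ellNorm p s) : ℝ≥0) : ℝ) := by
    simp only [← hsc, ellNorm, one_div]
    push_cast
    ring
  rw [hfin]
  refine rademacherAverage_le fun ε => luxemburg_le (mul_pos hD0 hU0) (coeFn_signedSum x hx ε) ?_
  refine hsmall _ ((measurable_signedSum hg ε).nnnorm.const_mul _) (le_trans ?_ (hD _ hI))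
  refine lintegral_mono fun t => ENNReal.coe_le_coe.2 (hψ.mono ?_)
  rw [mul_inv, mul_assoc]
  gcongr
  exact (nnnorm_signedSum_le _ _).trans (ellNorm_anti hp hp1 _)

/-- Khintchine and `ℓ_p ⊆ ℓ_2` control the mean over the signs of the modulars of the sums, scaled
by `U`. Since `p ≥ 1`, a quasi-norm is bounded by an affine function of this modular, and affine
bounds can be averaged. -/
theorem ModularComparison.hasType_of_one_le (hψ : ModularComparison φ μ ψ) {p q : ℝ} {c C : ℝ≥0}
    (h : LowerGrowth ψ p c) (hc : 0 < c) (hq : UpperGrowth ψ q C) (hp1 : 1 ≤ p) (hp2 : p ≤ 2) :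
    HasType (φ.luxemburg μ) p := by
  have hp : 0 < p := one_pos.trans_le hp1
  obtain ⟨B, hB⟩ := hψ.exists_convexity h hc hp
  obtain ⟨b, hb, hsmall⟩ := hψ.small
  obtain ⟨D, hD⟩ := hq.exists_khintchine hψ.mono
  -- Division by `a = 1 + κ m` reduces a modular `m` to at most `m / (c a ^ p) ≤ m / (c a) ≤ b`.
  set κ : ℝ≥0 := (c * b)⁻¹ with hκ
  refine ⟨hp, (2 ^ p⁻¹ * (1 + κ * (D * B)) : ℝ≥0), NNReal.coe_pos.2
    (mul_pos (NNReal.rpow_pos two_pos) (by positivity)), fun n x => ?_⟩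
  rcases Nat.eq_zero_or_pos n with rfl | hn
  · have h0 : φ.luxemburg μ 0 = 0 := by simpa using luxemburg_smul (0 : ℝ) (0 : φ.space μ)
    refine (rademacherAverage_le (M := 0) fun ε => ?_).trans ?_
    · simp [h0]
    · simp [Real.zero_rpow (inv_ne_zero hp.ne')]
  refine le_of_forall_pos_ellNorm hp fun δ hδ => ?_
  choose g hg hx using fun k => exists_measurable_ae_eq (x k)
  set s : Fin n → ℝ≥0 := fun k => (φ.luxemburg μ (x k) + δ).toNNReal with hs
  have hsc : ∀ k, (s k : ℝ) = φ.luxemburg μ (x k) + δ := fun k =>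
    Real.coe_toNNReal _ (add_nonneg (luxemburg_nonneg _) hδ.le)
  have hlt : ∀ k, φ.luxemburg μ (x k) < s k := fun k => by rw [hsc]; linarith
  have hI := hB n hn x g hg hx s hlt
  have hT0 : 0 < ellNorm p s := ellNorm_pos hp ⟨⟨0, hn⟩, by
    have := (luxemburg_nonneg (x ⟨0, hn⟩)).trans_lt (hlt ⟨0, hn⟩)
    exact_mod_cast this⟩
  set U : ℝ≥0 := 2 ^ p⁻¹ * ellNorm p s with hU
  have hU0 : 0 < U := mul_pos (NNReal.rpow_pos two_pos) hT0
  have hfin : ((2 ^ p⁻¹ * (1 + κ * (D * B)) : ℝ≥0) : ℝ) *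
      (∑ k, (φ.luxemburg μ (x k) + δ) ^ p) ^ (1 / p) =
      ((U * (1 + κ * (D * B)) : ℝ≥0) : ℝ) := by
    rw [hU]
    simp only [← hsc, ellNorm, one_div]
    push_cast
    ring
  rw [hfin]
  set m : (Fin n → Bool) → ℝ≥0∞ := fun ε =>
    ∫⁻ t, (ψ (U⁻¹ * ‖signedSum (fun k => g k t) ε‖₊) : ℝ≥0∞) ∂μ with hm
  have hmeas : ∀ ε, Measurable fun t =>
      (ψ (U⁻¹ * ‖signedSum (fun k => g k t) ε‖₊) : ℝ≥0∞) := fun ε =>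
    (hψ.mono.measurable.comp ((measurable_signedSum hg ε).nnnorm.const_mul _)).coe_nnreal_ennreal
  have hsum : ∑ ε, m ε ≤ ((2 ^ n * (D * B) : ℝ≥0) : ℝ≥0∞) := by
    rw [hm, ← lintegral_finsetSum _ fun ε _ => hmeas ε]
    calc _ ≤ ∫⁻ t, ((2 ^ n * D : ℝ≥0) : ℝ≥0∞) *
          (ψ (U⁻¹ * ellNorm p (fun k => ‖g k t‖₊)) : ℝ≥0∞) ∂μ := by
          refine lintegral_mono_of_forall_le fun t => ?_
          have h1 := hD n (fun k => (U⁻¹ : ℝ≥0) * g k t)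
          have h2 : ∀ ε, ‖signedSum (fun k => ((U⁻¹ : ℝ≥0) : ℝ) * g k t) ε‖₊ =
              U⁻¹ * ‖signedSum (fun k => g k t) ε‖₊ := by
            intro ε
            rw [← NNReal.nnnorm_eq U⁻¹, ← nnnorm_mul]
            congr 1
            simp only [signedSum, Finset.mul_sum, NNReal.nnnorm_eq]
            exact Finset.sum_congr rfl fun k _ => by ring
          simp only [h2, nnnorm_mul, NNReal.nnnorm_eq, ellNorm_mul two_pos] at h1
          rw [← mul_assoc] at h1
          have h3 := h1.trans (mul_le_mul_right (hψ.mono (mul_le_mul_right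
            (ellNorm_anti hp hp2 fun k => ‖g k t‖₊) U⁻¹)) _)
          exact_mod_cast h3
      _ ≤ ((2 ^ n * D : ℝ≥0) : ℝ≥0∞) * B := by
          rw [lintegral_const_mul' _ _ ENNReal.coe_ne_top]
          gcongr
      _ = _ := by rw [← ENNReal.coe_mul, mul_assoc]
  have hmtop : ∀ ε, m ε ≠ ∞ := fun ε =>
    (((Finset.single_le_sum (f := m) (fun _ _ => zero_le) (Finset.mem_univ ε)).trans
      hsum).trans_lt ENNReal.coe_lt_top).ne
  have hN : ∀ ε, φ.luxemburg μ (∑ k, boolSign (ε k) • x k) ≤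
      ((U * (1 + κ * (m ε).toNNReal) : ℝ≥0) : ℝ) := by
    intro ε
    set a : ℝ≥0 := 1 + κ * (m ε).toNNReal with ha
    have ha1 : 1 ≤ a := le_self_add
    have ha0 : 0 < a := one_pos.trans_le ha1
    rw [mul_comm]
    refine luxemburg_le (mul_pos ha0 hU0) (coeFn_signedSum x hx ε) ?_
    refine hsmall _ ((measurable_signedSum hg ε).nnnorm.const_mul _) ?_
    simp only [mul_inv, mul_assoc]
    refine (h.lintegral_le hc ha1 _).trans ?_
    have hpos : 0 < c * a ^ p := mul_pos hc (NNReal.rpow_pos ha0)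
    change ((c * a ^ p : ℝ≥0) : ℝ≥0∞)⁻¹ * m ε ≤ b
    rw [← ENNReal.coe_toNNReal (hmtop ε), ← ENNReal.coe_inv hpos.ne', ← ENNReal.coe_mul,
      ENNReal.coe_le_coe, inv_mul_le_iff₀ hpos]
    have h1 : a ≤ a ^ p := by
      simpa using NNReal.rpow_le_rpow_of_exponent_le ha1 hp1
    calc (m ε).toNNReal = c * (κ * (m ε).toNNReal) * b := by
          rw [hκ]; field_simp
      _ ≤ c * a ^ p * b := by
          gcongr
          exact le_trans le_add_self h1
  rw [rademacherAverage_eq, inv_mul_le_iff₀ (by positivity)]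
  refine (Finset.sum_le_sum fun ε _ => hN ε).trans ?_
  have hsum' : ∑ ε, (m ε).toNNReal ≤ 2 ^ n * (D * B) := by
    rw [← ENNReal.coe_le_coe]
    push_cast
    simp only [ENNReal.coe_toNNReal (hmtop _)]
    exact_mod_cast hsum
  have : ∑ ε, U * (1 + κ * (m ε).toNNReal) ≤ 2 ^ n * (U * (1 + κ * (D * B))) := by
    calc _ = 2 ^ n * U + U * κ * ∑ ε, (m ε).toNNReal := by
          simp only [mul_add, Finset.sum_add_distrib, ← Finset.mul_sum, ← mul_assoc]
          simp [mul_comm]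
      _ ≤ 2 ^ n * U + U * κ * (2 ^ n * (D * B)) := by gcongr
      _ = _ := by ring
  exact_mod_cast this

/-- The square function is dominated by the Rademacher average. -/
theorem ModularComparison.exists_squareFunction_le (hψ : ModularComparison φ μ ψ) {p : ℝ}
    {c : ℝ≥0} (h : LowerGrowth ψ p c) (hc : 0 < c) (hp : 0 < p) {b : ℝ≥0} (hb : 0 < b) :
    ∃ K : ℝ≥0, 0 < K ∧ ∀ (n : ℕ) (x : Fin n → φ.space μ) (g : Fin n → Ω → ℝ)
      (_ : ∀ k, Measurable (g k)) (_ : ∀ k, (x k : Ω →ₘ[μ] ℝ) =ᵐ[μ] g k) (δ : ℝ≥0)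
      (_ : rademacherAverage (φ.luxemburg μ) x < δ),
      ∫⁻ t, (ψ ((K * δ)⁻¹ * ellNorm 2 (fun k => ‖g k t‖₊)) : ℝ≥0∞) ∂μ ≤ b := by
  obtain ⟨B, hB⟩ := hψ.bound
  obtain ⟨D, hD1, hD⟩ := h.exists_scale (μ := μ) hc hp (28 / 3 * B) hb
  have hD0 : 0 < D := one_pos.trans_le hD1
  refine ⟨D * (56 / 3), by positivity, fun n x g hg hx δ hδ => ?_⟩
  have hδ0 : 0 < δ := by
    have h0 : 0 ≤ rademacherAverage (φ.luxemburg μ) x :=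
      le_rademacherAverage fun ε => luxemburg_nonneg _
    exact_mod_cast h0.trans_lt hδ
  -- By Markov at most the fraction `3 / 28` of the signs gives quasi-norm at least `U`. By
  -- Paley-Zygmund at least `3 / 14` of them satisfy, at a given point, that the square function is
  -- at most twice the signed sum. Hence at least `3 / 28` of the signs are good in both ways.
  set U : ℝ≥0 := 28 / 3 * δ with hU
  have hU0 : 0 < U := by positivity
  have e : ∀ z : ℝ≥0, (D * (56 / 3) * δ)⁻¹ * z = D⁻¹ * ((2 * U)⁻¹ * z) := by
    intro z
    rw [hU, ← mul_assoc, ← mul_inv]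
    congr 2
    ring
  simp only [e]
  refine hD _ ?_
  classical
  set N : (Fin n → Bool) → ℝ := fun ε => φ.luxemburg μ (∑ k, boolSign (ε k) • x k) with hN
  set G : Finset (Fin n → Bool) := Finset.univ.filter fun ε => N ε < U with hG
  have hGc : ((Gᶜ).card : ℝ) * (28 / 3) ≤ 2 ^ n := by
    have h1 : ((Gᶜ).card : ℝ) * U ≤ ∑ ε, N ε := by
      calc ((Gᶜ).card : ℝ) * U = ∑ ε ∈ Gᶜ, (U : ℝ) := by simp
        _ ≤ ∑ ε ∈ Gᶜ, N ε := Finset.sum_le_sum fun ε hε => by simpa [hG] using hε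
        _ ≤ _ := Finset.sum_le_univ_sum_of_nonneg fun ε => luxemburg_nonneg _
    have h2 : ∑ ε, N ε ≤ 2 ^ n * δ := by
      rw [rademacherAverage_eq, inv_mul_lt_iff₀ (by positivity)] at hδ
      exact hδ.le
    have hδ0' : (0 : ℝ) < δ := hδ0
    have h3 : ((Gᶜ).card : ℝ) * (28 / 3) * δ ≤ 2 ^ n * δ := by
      refine le_trans (le_of_eq ?_) (h1.trans h2)
      rw [hU]; push_cast; ring
    exact le_of_mul_le_mul_right h3 hδ0'
  have hpt : ∀ t, 2 ^ n * ψ ((2 * U)⁻¹ * ellNorm 2 (fun k => ‖g k t‖₊)) ≤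
      28 / 3 * ∑ ε ∈ G, ψ (U⁻¹ * ‖signedSum (fun k => g k t) ε‖₊) := by
    intro t
    set H := Finset.univ.filter fun ε =>
      ellNorm 2 (fun k => ‖g k t‖₊) ≤ 2 * ‖signedSum (fun k => g k t) ε‖₊ with hH
    have hHc := card_ellNorm_two_le fun k => g k t
    rw [← hH] at hHc
    have hcard : (2 : ℝ) ^ n ≤ 28 / 3 * ((G ∩ H).card : ℝ) := by
      have h1 : H.card ≤ (G ∩ H).card + (Gᶜ).card := by
        refine le_trans (Finset.card_le_card fun ε hε => ?_) (Finset.card_union_le _ _)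
        simp only [Finset.mem_union, Finset.mem_inter, Finset.mem_compl]
        tauto
      have h2 : (H.card : ℝ) ≤ (G ∩ H).card + (Gᶜ).card := by exact_mod_cast h1
      linarith
    have hcard' : (2 : ℝ≥0) ^ n ≤ 28 / 3 * ((G ∩ H).card : ℝ≥0) := by
      rw [← NNReal.coe_le_coe]; push_cast; exact hcard
    calc _ ≤ 28 / 3 * ((G ∩ H).card : ℝ≥0) * ψ ((2 * U)⁻¹ * ellNorm 2 (fun k => ‖g k t‖₊)) := by
          gcongr
      _ = 28 / 3 * ∑ ε ∈ G ∩ H, ψ ((2 * U)⁻¹ * ellNorm 2 (fun k => ‖g k t‖₊)) := by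
          rw [Finset.sum_const, nsmul_eq_mul, mul_assoc]
      _ ≤ 28 / 3 * ∑ ε ∈ G ∩ H, ψ (U⁻¹ * ‖signedSum (fun k => g k t) ε‖₊) := by
          refine mul_le_mul_right (Finset.sum_le_sum fun ε hε => hψ.mono ?_) _
          have hε' : ellNorm 2 (fun k => ‖g k t‖₊) ≤ 2 * ‖signedSum (fun k => g k t) ε‖₊ := by
            simpa [hH] using (Finset.mem_inter.1 hε).2
          calc _ ≤ (2 * U)⁻¹ * (2 * ‖signedSum (fun k => g k t) ε‖₊) := by gcongr
            _ = _ := by rw [mul_inv]; field_simp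
      _ ≤ _ := by
          gcongr
          exact Finset.inter_subset_left
  have hmeas : ∀ ε, Measurable fun t =>
      (ψ (U⁻¹ * ‖signedSum (fun k => g k t) ε‖₊) : ℝ≥0∞) := fun ε =>
    (hψ.mono.measurable.comp ((measurable_signedSum hg ε).nnnorm.const_mul _)).coe_nnreal_ennreal
  have hint : ((2 ^ n : ℝ≥0) : ℝ≥0∞) *
      ∫⁻ t, (ψ ((2 * U)⁻¹ * ellNorm 2 (fun k => ‖g k t‖₊)) : ℝ≥0∞) ∂μ ≤
      ((2 ^ n : ℝ≥0) : ℝ≥0∞) * ((28 / 3 * B : ℝ≥0) : ℝ≥0∞) := by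
    rw [← lintegral_const_mul' _ _ ENNReal.coe_ne_top]
    calc _ ≤ ∫⁻ t, ((28 / 3 : ℝ≥0) : ℝ≥0∞) *
          ∑ ε ∈ G, (ψ (U⁻¹ * ‖signedSum (fun k => g k t) ε‖₊) : ℝ≥0∞) ∂μ :=
          lintegral_mono_of_forall_le fun t => by exact_mod_cast hpt t
      _ = ((28 / 3 : ℝ≥0) : ℝ≥0∞) *
          ∑ ε ∈ G, ∫⁻ t, (ψ (U⁻¹ * ‖signedSum (fun k => g k t) ε‖₊) : ℝ≥0∞) ∂μ := by
          rw [lintegral_const_mul' _ _ ENNReal.coe_ne_top,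
            lintegral_finsetSum _ fun ε _ => hmeas ε]
      _ ≤ ((28 / 3 : ℝ≥0) : ℝ≥0∞) * ∑ ε ∈ G, (B : ℝ≥0∞) := by
          refine mul_le_mul_right (Finset.sum_le_sum fun ε hε => ?_) _
          refine hB _ ((measurable_signedSum hg ε).nnnorm.const_mul _)
            (modular_le_one_of_lt ?_ (coeFn_signedSum x hx ε))
          simpa [hG] using hε
      _ ≤ ((28 / 3 : ℝ≥0) : ℝ≥0∞) * ∑ ε : Fin n → Bool, (B : ℝ≥0∞) := by
          gcongr
          exact Finset.subset_univ _
      _ = _ := by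
          rw [← ENNReal.ofNNReal_finsetSum, ← ENNReal.coe_mul, ← ENNReal.coe_mul]
          congr 1
          simp
          ring
  have h2n : ((2 ^ n : ℝ≥0) : ℝ≥0∞) ≠ 0 := by simp
  exact (ENNReal.mul_le_mul_iff_right h2n ENNReal.coe_ne_top).1 hint

/-- Each `|x_k|` is dominated pointwise by the square function. -/
theorem ModularComparison.hasCotype_top (hψ : ModularComparison φ μ ψ) {p : ℝ} {c : ℝ≥0}
    (h : LowerGrowth ψ p c) (hc : 0 < c) (hp : 0 < p) : HasCotype (φ.luxemburg μ) ⊤ := by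
  obtain ⟨b, hb, hsmall⟩ := hψ.small
  obtain ⟨K, hK, hsq⟩ := hψ.exists_squareFunction_le h hc hp hb
  refine ⟨EReal.zero_lt_top, K, hK, fun n x => ?_⟩
  choose g hg hx using fun k => exists_measurable_ae_eq (x k)
  have h0 : 0 ≤ rademacherAverage (φ.luxemburg μ) x :=
    le_rademacherAverage fun ε => luxemburg_nonneg _
  rw [lqSum, if_pos rfl]
  refine Real.iSup_le (fun k => ?_) (by positivity)
  rw [← div_le_iff₀' (by exact_mod_cast hK)]
  refine le_of_forall_gt_imp_ge_of_dense fun δ hδ => ?_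
  have hδ0 : 0 < δ := h0.trans_lt hδ
  lift δ to ℝ≥0 using hδ0.le
  rw [div_le_iff₀' (by exact_mod_cast hK), ← NNReal.coe_mul]
  refine luxemburg_le (mul_pos hK (by exact_mod_cast hδ0)) (hx k) ?_
  refine hsmall _ ((hg k).nnnorm.const_mul _) (le_trans ?_ (hsq n x g hg hx δ hδ))
  refine lintegral_mono fun t => ENNReal.coe_le_coe.2 (hψ.mono ?_)
  gcongr
  exact le_ellNorm two_pos (fun k => ‖g k t‖₊) k

/-- If the `ℓ_s` sum `T` of the norms `ν_k` exceeded `2 K δ`, each `x_k` with `ν_k > 0`, divided by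
`ν_k / 2`, would have `ψ`-modular at least `b`. Averaging with weights `(ν_k / T) ^ s`, reverse
Jensen and `ℓ_2 ⊆ ℓ_s` bound the mean by `C + 1` times the modular of the scaled square function,
which is too small. -/
theorem ModularComparison.hasCotype (hψ : ModularComparison φ μ ψ) {p s : ℝ} {c C : ℝ≥0}
    (h : LowerGrowth ψ p c) (hc : 0 < c) (hp : 0 < p) (hs : UpperGrowth ψ s C) (hs2 : 2 ≤ s) :
    HasCotype (φ.luxemburg μ) (s : EReal) := by
  have hs0 : 0 < s := two_pos.trans_le hs2
  obtain ⟨b, hb, hsmall⟩ := hψ.small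
  -- Chosen so that `(C + 1) b' = b / 2 < b` is the final contradiction.
  set b' : ℝ≥0 := b / (2 * (C + 1)) with hb'
  have hb0 : 0 < b' := by positivity
  obtain ⟨K, hK, hsq⟩ := hψ.exists_squareFunction_le h hc hp hb0
  refine ⟨by exact_mod_cast hs0, (2 * K : ℝ≥0), by exact_mod_cast mul_pos two_pos hK,
    fun n x => ?_⟩
  choose g hg hx using fun k => exists_measurable_ae_eq (x k)
  have h0 : 0 ≤ rademacherAverage (φ.luxemburg μ) x :=
    le_rademacherAverage fun ε => luxemburg_nonneg _
  rw [lqSum, if_neg (EReal.coe_ne_top s), EReal.toReal_coe]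
  have h2K : (0 : ℝ) < (2 * K : ℝ≥0) := by exact_mod_cast mul_pos two_pos hK
  rw [← div_le_iff₀' h2K]
  refine le_of_forall_gt_imp_ge_of_dense fun δ hδ => ?_
  have hδ0 : 0 < δ := h0.trans_lt hδ
  lift δ to ℝ≥0 using hδ0.le
  rw [div_le_iff₀' h2K, ← NNReal.coe_mul]
  set ν : Fin n → ℝ≥0 := fun k => (φ.luxemburg μ (x k)).toNNReal with hν
  have hνc : ∀ k, (ν k : ℝ) = φ.luxemburg μ (x k) := fun k =>
    Real.coe_toNNReal _ (luxemburg_nonneg _)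
  set T := ellNorm s ν with hT
  have hTc : (∑ k, φ.luxemburg μ (x k) ^ s) ^ (1 / s) = (T : ℝ) := by
    simp only [hT, ← hνc, ellNorm, one_div]
    push_cast
    rfl
  rw [hTc, NNReal.coe_le_coe]
  by_contra! hlt
  have hδ' : 0 < δ := by exact_mod_cast hδ0
  have hT0 : 0 < T := (by positivity : 0 < 2 * K * δ).trans hlt
  have hl : ∑ k, (ν k / T) ^ s = 1 := by
    simp only [NNReal.div_rpow, ← Finset.sum_div]
    rw [← ellNorm_rpow hs0, ← hT, div_self (NNReal.rpow_pos hT0).ne']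
  have hbig : ∀ k, (((ν k / T) ^ s : ℝ≥0) : ℝ≥0∞) * b ≤ (((ν k / T) ^ s : ℝ≥0) : ℝ≥0∞) *
      ∫⁻ t, (ψ ((ν k / 2)⁻¹ * ‖g k t‖₊) : ℝ≥0∞) ∂μ := by
    intro k
    rcases eq_or_ne (ν k) 0 with hk | hk
    · simp [hk, NNReal.zero_rpow hs0.ne']
    · refine mul_le_mul_right (le_of_not_gt fun hcon => ?_) _
      have hk0 : 0 < ν k := pos_iff_ne_zero.2 hk
      have h1 := luxemburg_le (half_pos hk0) (hx k)
        (hsmall _ ((hg k).nnnorm.const_mul _) hcon.le)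
      rw [← hνc, NNReal.coe_le_coe] at h1
      exact absurd h1 (not_le.2 (half_lt_self hk0))
  have hpt : ∀ t, ∑ k, (ν k / T) ^ s * ψ ((ν k / 2)⁻¹ * ‖g k t‖₊) ≤
      (C + 1) * ψ ((K * δ)⁻¹ * ellNorm 2 (fun k => ‖g k t‖₊)) := by
    intro t
    refine (hs.le_ellNorm hψ.mono hs0 (fun k => ν k / T) _ hl).trans
      (mul_le_mul_right (hψ.mono ?_) _)
    have h1 : ∀ k, ν k / T * ((ν k / 2)⁻¹ * ‖g k t‖₊) ≤ (K * δ)⁻¹ * ‖g k t‖₊ := by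
      intro k
      rw [← mul_assoc]
      gcongr
      rcases eq_or_ne (ν k) 0 with hk | hk
      · simp [hk]
      · rw [le_inv_comm₀ (by positivity) (by positivity)]
        refine le_trans ?_ (le_of_eq (by field_simp : T / 2 = (ν k / T * (ν k / 2)⁻¹)⁻¹))
        rw [le_div_iff₀ two_pos]
        refine le_trans (le_of_eq ?_) hlt.le
        ring
    calc _ ≤ ellNorm s (fun k => (K * δ)⁻¹ * ‖g k t‖₊) := ellNorm_mono hs0 h1
      _ = (K * δ)⁻¹ * ellNorm s (fun k => ‖g k t‖₊) := ellNorm_mul hs0 _ _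
      _ ≤ _ := by
        gcongr
        exact ellNorm_anti two_pos hs2 _
  have hmeas : ∀ k, Measurable fun t => (ψ ((ν k / 2)⁻¹ * ‖g k t‖₊) : ℝ≥0∞) := fun k =>
    (hψ.mono.measurable.comp ((hg k).nnnorm.const_mul _)).coe_nnreal_ennreal
  have hfin : (b : ℝ≥0∞) ≤ ((C + 1 : ℝ≥0) : ℝ≥0∞) * b' := by
    calc (b : ℝ≥0∞) = ((∑ k, (ν k / T) ^ s * b : ℝ≥0) : ℝ≥0∞) := by
          rw [← Finset.sum_mul, hl, one_mul]
      _ = ∑ k, (((ν k / T) ^ s : ℝ≥0) : ℝ≥0∞) * b := by push_cast; rfl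
      _ ≤ ∑ k, (((ν k / T) ^ s : ℝ≥0) : ℝ≥0∞) *
          ∫⁻ t, (ψ ((ν k / 2)⁻¹ * ‖g k t‖₊) : ℝ≥0∞) ∂μ := Finset.sum_le_sum fun k _ => hbig k
      _ = ∫⁻ t, ∑ k, (((ν k / T) ^ s : ℝ≥0) : ℝ≥0∞) *
          (ψ ((ν k / 2)⁻¹ * ‖g k t‖₊) : ℝ≥0∞) ∂μ := by
          rw [lintegral_finsetSum _ fun k _ => (hmeas k).const_mul _]
          exact Finset.sum_congr rfl fun k _ =>
            (lintegral_const_mul' _ _ ENNReal.coe_ne_top).symm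
      _ ≤ ∫⁻ t, ((C + 1 : ℝ≥0) : ℝ≥0∞) *
          (ψ ((K * δ)⁻¹ * ellNorm 2 (fun k => ‖g k t‖₊)) : ℝ≥0∞) ∂μ :=
          lintegral_mono_of_forall_le fun t => by exact_mod_cast hpt t
      _ ≤ _ := by
          rw [lintegral_const_mul' _ _ ENNReal.coe_ne_top]
          gcongr
          exact hsq n x g hg hx δ hδ
  rw [← ENNReal.coe_mul, ENNReal.coe_le_coe, hb'] at hfin
  have h3 : (C + 1) * (b / (2 * (C + 1))) = b / 2 := by field_simp
  rw [h3] at hfin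
  exact absurd hfin (not_le.2 (half_lt_self hb))

end OrliczFunction

/-! ### From a restricted range of arguments to all arguments. -/

theorem ArgumentRange.Holds.mono {r : ArgumentRange} {P Q : ℝ≥0 → ℝ≥0 → Prop} (hP : r.Holds P)
    (h : ∀ a u, 1 ≤ a → P a u → Q a u) : r.Holds Q := by
  cases r with
  | all => exact fun a u ha => h a u ha (hP a u ha)
  | large => exact hP.imp fun v hv a u ha hu => h a u ha (hv a u ha hu)
  | small => exact hP.imp fun v hv => ⟨hv.1, fun a u ha hu hau => h a u ha (hv.2 a u ha hu hau)⟩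

theorem ArgumentRange.Holds.and {r : ArgumentRange} {P Q : ℝ≥0 → ℝ≥0 → Prop} (hP : r.Holds P)
    (hQ : r.Holds Q) : r.Holds fun a u => P a u ∧ Q a u := by
  cases r with
  | all => exact fun a u ha => ⟨hP a u ha, hQ a u ha⟩
  | large =>
    obtain ⟨v, hv⟩ := hP
    obtain ⟨w, hw⟩ := hQ
    exact ⟨max v w, fun a u ha hu => ⟨hv a u ha ((le_max_left _ _).trans hu),
      hw a u ha ((le_max_right _ _).trans hu)⟩⟩
  | small =>
    obtain ⟨v, hv0, hv⟩ := hP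
    obtain ⟨w, hw0, hw⟩ := hQ
    exact ⟨min v w, lt_min hv0 hw0, fun a u ha hu hau =>
      ⟨hv a u ha hu (hau.trans (min_le_left _ _)), hw a u ha hu (hau.trans (min_le_right _ _))⟩⟩

/-- Splits the dilation by `a` at the level `v`: `d` is the part performed below `v` and `b` the
part above, so each piece of a two-piece function meets its own growth estimate. -/
theorem NNReal.exists_max_min_mul {a v : ℝ≥0} (u : ℝ≥0) (ha : 1 ≤ a) (hv : 0 < v) :
    ∃ b d : ℝ≥0, 1 ≤ b ∧ 1 ≤ d ∧ b * d = a ∧ max (a * u) v = b * max u v ∧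
      min (a * u) v = d * min u v := by
  have hau : u ≤ a * u := le_mul_of_one_le_left zero_le ha
  rcases le_total v u with h | h
  · exact ⟨a, 1, ha, le_rfl, mul_one a, by rw [max_eq_left h, max_eq_left (h.trans hau)],
      by rw [min_eq_right h, min_eq_right (h.trans hau), one_mul]⟩
  · rcases le_total (a * u) v with h' | h'
    · exact ⟨1, a, le_rfl, ha, one_mul a, by rw [max_eq_right h, max_eq_right h', one_mul],
        by rw [min_eq_left h, min_eq_left h']⟩
    · have hu : 0 < u := by
        rcases eq_or_ne u 0 with rfl | hu
        · simp at h'; exact absurd h' hv.ne'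
        · exact pos_iff_ne_zero.2 hu
      refine ⟨a * u / v, v / u, (one_le_div hv).2 h', (one_le_div hu).2 h, by field_simp, ?_, ?_⟩
      · rw [max_eq_left h', max_eq_right h]; field_simp
      · rw [min_eq_right h', min_eq_left h]; field_simp

namespace OrliczFunction

variable {Ω : Type*} [MeasurableSpace Ω] {φ : OrliczFunction} {μ : Measure Ω}

theorem pos {φ : OrliczFunction} {u : ℝ≥0} (hu : 0 < u) : 0 < φ u := by
  simpa [φ.map_zero] using φ.strictMono hu

/-- The function that agrees with `φ` on `[v, ∞)` and is a multiple of `u ^ p` on `[0, v]`. -/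
noncomputable def powBelow (φ : OrliczFunction) (p : ℝ) (v u : ℝ≥0) : ℝ≥0 :=
  φ (max u v) * (min u v / v) ^ p

/-- The function that agrees with `φ` on `[0, v]` and is a multiple of `u ^ p` on `[v, ∞)`. -/
noncomputable def powAbove (φ : OrliczFunction) (p : ℝ) (v u : ℝ≥0) : ℝ≥0 :=
  φ (min u v) * (max u v / v) ^ p

theorem powBelow_monotone {p : ℝ} (hp : 0 < p) (v : ℝ≥0) : Monotone (φ.powBelow p v) := by
  intro u w h
  exact mul_le_mul' (φ.strictMono.monotone (max_le_max_right _ h))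
    (NNReal.rpow_le_rpow (by gcongr) hp.le)

theorem powAbove_monotone {p : ℝ} (hp : 0 < p) (v : ℝ≥0) : Monotone (φ.powAbove p v) := by
  intro u w h
  exact mul_le_mul' (φ.strictMono.monotone (min_le_min_right _ h))
    (NNReal.rpow_le_rpow (by gcongr) hp.le)

theorem powBelow_lowerGrowth {p : ℝ} {v c : ℝ≥0} (hv : 0 < v)
    (h : ∀ a u : ℝ≥0, 1 ≤ a → v ≤ u → c * a ^ p * φ u ≤ φ (a * u)) :
    LowerGrowth (φ.powBelow p v) p c := by
  intro a u ha
  obtain ⟨b, d, hb, -, rfl, h1, h2⟩ := NNReal.exists_max_min_mul u ha hv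
  unfold powBelow
  rw [h1, h2, mul_div_assoc, NNReal.mul_rpow, NNReal.mul_rpow]
  calc _ = c * b ^ p * φ (max u v) * (d ^ p * (min u v / v) ^ p) := by ring
    _ ≤ _ := by gcongr; exact h b _ hb (le_max_right _ _)

theorem powBelow_upperGrowth {p q : ℝ} {v C : ℝ≥0} (hv : 0 < v) (hpq : p ≤ q)
    (h : ∀ a u : ℝ≥0, 1 ≤ a → v ≤ u → φ (a * u) ≤ C * a ^ q * φ u) :
    UpperGrowth (φ.powBelow p v) q C := by
  intro a u ha
  obtain ⟨b, d, hb, hd, rfl, h1, h2⟩ := NNReal.exists_max_min_mul u ha hv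
  unfold powBelow
  rw [h1, h2, mul_div_assoc, NNReal.mul_rpow, NNReal.mul_rpow]
  calc _ ≤ C * b ^ q * φ (max u v) * (d ^ q * (min u v / v) ^ p) := by
        gcongr
        exact h b _ hb (le_max_right _ _)
    _ = _ := by ring

theorem powAbove_lowerGrowth {p : ℝ} {v c : ℝ≥0} (hv : 0 < v)
    (h : ∀ a u : ℝ≥0, 1 ≤ a → 0 < u → a * u ≤ v → c * a ^ p * φ u ≤ φ (a * u)) :
    LowerGrowth (φ.powAbove p v) p c := by
  intro a u ha
  rcases eq_or_ne u 0 with rfl | hu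
  · simp [powAbove, φ.map_zero]
  obtain ⟨b, d, -, hd, rfl, h1, h2⟩ := NNReal.exists_max_min_mul u ha hv
  unfold powAbove
  have h3 := h d (min u v) hd (lt_min (pos_iff_ne_zero.2 hu) hv) (h2 ▸ min_le_right _ _)
  rw [h1, h2, mul_div_assoc, NNReal.mul_rpow, NNReal.mul_rpow]
  calc _ = c * d ^ p * φ (min u v) * (b ^ p * (max u v / v) ^ p) := by ring
    _ ≤ _ := by gcongr

theorem powAbove_upperGrowth {p q : ℝ} {v C : ℝ≥0} (hv : 0 < v) (hpq : p ≤ q)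
    (h : ∀ a u : ℝ≥0, 1 ≤ a → 0 < u → a * u ≤ v → φ (a * u) ≤ C * a ^ q * φ u) :
    UpperGrowth (φ.powAbove p v) q C := by
  intro a u ha
  rcases eq_or_ne u 0 with rfl | hu
  · simp [powAbove, φ.map_zero]
  obtain ⟨b, d, hb, hd, rfl, h1, h2⟩ := NNReal.exists_max_min_mul u ha hv
  unfold powAbove
  have h3 := h d (min u v) hd (lt_min (pos_iff_ne_zero.2 hu) hv) (h2 ▸ min_le_right _ _)
  rw [h1, h2, mul_div_assoc, NNReal.mul_rpow, NNReal.mul_rpow]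
  calc _ ≤ C * d ^ q * φ (min u v) * (b ^ q * (max u v / v) ^ p) := by gcongr
    _ = _ := by ring

theorem modularComparison_self : ModularComparison φ μ φ where
  mono := φ.strictMono.monotone
  bound := ⟨1, fun _ _ h => by simpa using h⟩
  small := ⟨1, one_pos, fun _ _ h => by simpa using h⟩

theorem exists_pos_mul_le (φ : OrliczFunction) (M : ℝ≥0) {b : ℝ≥0} (hb : 0 < b) :
    ∃ u : ℝ≥0, 0 < u ∧ φ u * M ≤ b := by
  have h : Tendsto (fun u => φ u * M) (𝓝[>] 0) (𝓝 (φ 0 * M)) :=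
    ((φ.continuous.mul continuous_const).tendsto 0).mono_left nhdsWithin_le_nhds
  rw [φ.map_zero, zero_mul] at h
  obtain ⟨u, h1, h2⟩ := ((h.eventually (Iic_mem_nhds hb)).and eventually_mem_nhdsWithin).exists
  exact ⟨u, h2, h1⟩

/-- Changing `φ` below `v` changes the modular by at most a bounded amount on a finite measure
space. For the converse, arguments below a small `η` contribute at most `φ η · μ(Ω) ≤ 1 / 2`, and
above `η` the functions are comparable. -/
theorem modularComparison_powBelow {p : ℝ} {v : ℝ≥0} (hv : 0 < v) (hp : 0 < p)
    (hμ : μ Set.univ < ∞) : ModularComparison φ μ (φ.powBelow p v) := by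
  obtain ⟨M, hM⟩ : ∃ M : ℝ≥0, (M : ℝ≥0∞) = μ Set.univ := ⟨_, ENNReal.coe_toNNReal hμ.ne⟩
  have hconst : ∀ x : ℝ≥0, ∫⁻ _, (x : ℝ≥0∞) ∂μ = ((x * M : ℝ≥0) : ℝ≥0∞) := fun x => by
    rw [lintegral_const, ← hM, ENNReal.coe_mul]
  refine ⟨powBelow_monotone hp v, ⟨1 + φ v * M, fun g hg h => ?_⟩, ?_⟩
  · have key : ∀ u, φ.powBelow p v u ≤ φ u + φ v := by
      intro u
      have h1 : (min u v / v) ^ p ≤ 1 :=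
        NNReal.rpow_le_one ((div_le_one hv).2 (min_le_right _ _)) hp.le
      refine (mul_le_of_le_one_right zero_le h1).trans ?_
      rcases max_cases u v with h | h <;> rw [h.1]
      · exact le_self_add
      · exact le_add_self
    calc _ ≤ ∫⁻ t, ((φ (g t) : ℝ≥0∞) + (φ v : ℝ≥0∞)) ∂μ :=
          lintegral_mono_of_forall_le fun t => by exact_mod_cast key (g t)
      _ ≤ _ := by
          rw [lintegral_add_right _ measurable_const, hconst, ENNReal.coe_add]
          gcongr
          simpa using h
  · obtain ⟨η, hη, hηM⟩ := φ.exists_pos_mul_le M (one_half_pos (α := ℝ≥0))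
    obtain ⟨L, hL⟩ : ∃ L : ℝ≥0, L = 1 + (v / η) ^ p := ⟨_, rfl⟩
    have hL0 : 0 < L := by rw [hL]; positivity
    have key : ∀ u, φ u ≤ φ η + L * φ.powBelow p v u := by
      intro u
      rcases le_total u η with h | h
      · exact (φ.strictMono.monotone h).trans le_self_add
      · refine le_trans ?_ le_add_self
        unfold powBelow
        rcases le_total u v with h' | h'
        · rw [max_eq_right h', min_eq_left h']
          have h1 : 1 ≤ (v / η) ^ p * (u / v) ^ p := by
            rw [← NNReal.mul_rpow]
            refine NNReal.one_le_rpow ?_ hp.le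
            rw [div_mul_div_cancel₀' hv.ne', one_le_div hη]
            exact h
          calc φ u ≤ φ v := φ.strictMono.monotone h'
            _ ≤ φ v * ((v / η) ^ p * (u / v) ^ p) := le_mul_of_one_le_right zero_le h1
            _ = (v / η) ^ p * (φ v * (u / v) ^ p) := by ring
            _ ≤ _ := by gcongr; rw [hL]; exact le_add_self
        · rw [max_eq_left h', min_eq_right h', div_self hv.ne', NNReal.one_rpow, mul_one]
          exact le_mul_of_one_le_left zero_le (by rw [hL]; exact le_self_add)
    refine ⟨(2 * L)⁻¹, by positivity, fun g hg h => ?_⟩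
    calc _ ≤ ∫⁻ t, ((φ η : ℝ≥0∞) + (L : ℝ≥0∞) * (φ.powBelow p v (g t) : ℝ≥0∞)) ∂μ :=
          lintegral_mono_of_forall_le fun t => by exact_mod_cast key (g t)
      _ ≤ ((φ η * M + L * (2 * L)⁻¹ : ℝ≥0) : ℝ≥0∞) := by
          rw [lintegral_add_left measurable_const, hconst,
            lintegral_const_mul' _ _ ENNReal.coe_ne_top, ENNReal.coe_add, ENNReal.coe_mul L]
          gcongr
      _ ≤ ((1 / 2 + 1 / 2 : ℝ≥0) : ℝ≥0∞) := by
          refine ENNReal.coe_le_coe.2 (add_le_add hηM (le_of_eq ?_))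
          field_simp
      _ = 1 := by rw [add_halves]; rfl

theorem le_lintegral_of_measurePreserving_count {e : Ω ≃ᵐ ℕ}
    (he : MeasurePreserving e μ Measure.count) (f : Ω → ℝ≥0∞) (t : Ω) : f t ≤ ∫⁻ s, f s ∂μ := by
  have h := he.lintegral_comp (f := fun n => f (e.symm n)) (measurable_from_top)
  simp only [MeasurableEquiv.symm_apply_apply, lintegral_count] at h
  rw [h]
  simpa using ENNReal.le_tsum (f := fun n => f (e.symm n)) (e t)

/-- Points have mass 1, so a bounded modular bounds every value. If the modular of `φ` is at most 1,
all values lie below a fixed `V`, where the functions are comparable; if that of the extension is at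
most `φ v`, all values lie below `v`, where they coincide. -/
theorem modularComparison_powAbove {p : ℝ} {v : ℝ≥0} (hv : 0 < v) (hp : 0 < p) {e : Ω ≃ᵐ ℕ}
    (he : MeasurePreserving e μ Measure.count) : ModularComparison φ μ (φ.powAbove p v) := by
  refine ⟨powAbove_monotone hp v, ?_, min (φ v) 1, lt_min (pos hv) one_pos, fun g hg h => ?_⟩
  · obtain ⟨V, hV, hvV⟩ := ((φ.tendsto_atTop.eventually_ge_atTop 1).and
      (eventually_ge_atTop v)).exists
    refine ⟨(V / v) ^ p, fun g hg h => ?_⟩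
    have hle : ∀ t, g t ≤ V := fun t => by
      have h1 := (le_lintegral_of_measurePreserving_count he (fun t => (φ (g t) : ℝ≥0∞)) t).trans h
      have h2 : φ (g t) ≤ φ V := le_trans (by exact_mod_cast h1) hV
      exact φ.strictMono.le_iff_le.1 h2
    have key : ∀ t, φ.powAbove p v (g t) ≤ (V / v) ^ p * φ (g t) := fun t => by
      unfold powAbove
      rw [mul_comm]
      refine mul_le_mul' (NNReal.rpow_le_rpow ?_ hp.le) (φ.strictMono.monotone (min_le_left _ _))
      gcongr
      exact max_le (hle t) hvV
    calc _ ≤ ∫⁻ t, (((V / v) ^ p : ℝ≥0) : ℝ≥0∞) * (φ (g t) : ℝ≥0∞) ∂μ :=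
          lintegral_mono_of_forall_le fun t => by exact_mod_cast key t
      _ ≤ (((V / v) ^ p : ℝ≥0) : ℝ≥0∞) * 1 := by
          rw [lintegral_const_mul' _ _ ENNReal.coe_ne_top]
          gcongr
      _ = _ := mul_one _
  · have hle : ∀ t, g t ≤ v := fun t => by
      have h1 := (le_lintegral_of_measurePreserving_count he
        (fun t => (φ.powAbove p v (g t) : ℝ≥0∞)) t).trans h
      have h2 : φ.powAbove p v (g t) ≤ φ v :=
        (ENNReal.coe_le_coe.1 h1).trans (min_le_left _ _)
      by_contra! hlt
      refine absurd h2 (not_le.2 ?_)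
      unfold powAbove
      rw [min_eq_right hlt.le, max_eq_left hlt.le]
      exact lt_mul_of_one_lt_right (pos hv) (NNReal.one_lt_rpow ((one_lt_div hv).2 hlt) hp)
    have key : ∀ t, φ (g t) = φ.powAbove p v (g t) := fun t => by
      unfold powAbove
      rw [min_eq_left (hle t), max_eq_right (hle t), div_self hv.ne', NNReal.one_rpow, mul_one]
    simp only [key]
    exact h.trans (by exact_mod_cast min_le_right _ _)

/-- On the measure spaces that go with its range, a growth condition may be assumed for all
arguments. -/
theorem exists_modularComparison {r : ArgumentRange} (hμ : r.Matches μ) {p q : ℝ} {c C : ℝ≥0}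
    (hp : 0 < p) (hpq : p ≤ q) (Q : Prop)
    (h : r.Holds fun a u => c * a ^ p * φ u ≤ φ (a * u))
    (hQ : Q → r.Holds fun a u => φ (a * u) ≤ C * a ^ q * φ u) :
    ∃ ψ : ℝ≥0 → ℝ≥0, ModularComparison φ μ ψ ∧ LowerGrowth ψ p c ∧ (Q → UpperGrowth ψ q C) := by
  -- One threshold, hence one `ψ`, must serve both conditions; `Q` switches the upper one off when
  -- the upper index is infinite.
  have h' : r.Holds fun a u => c * a ^ p * φ u ≤ φ (a * u) ∧
      (Q → φ (a * u) ≤ C * a ^ q * φ u) := by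
    by_cases hq : Q
    · exact (h.and (hQ hq)).mono fun a u _ H => ⟨H.1, fun _ => H.2⟩
    · exact h.mono fun a u _ H => ⟨H, fun hq' => absurd hq' hq⟩
  cases r with
  | all =>
    exact ⟨φ, modularComparison_self, fun a u ha => (h' a u ha).1,
      fun hq a u ha => (h' a u ha).2 hq⟩
  | large =>
    obtain ⟨v, hv⟩ := h'
    -- The given threshold may be 0, whereas the extension divides by it.
    have hv0 : 0 < max v 1 := lt_max_of_lt_right one_pos
    exact ⟨φ.powBelow p (max v 1), modularComparison_powBelow hv0 hp hμ.2.2,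
      powBelow_lowerGrowth hv0 fun a u ha hu => (hv a u ha ((le_max_left _ _).trans hu)).1,
      fun hq => powBelow_upperGrowth hv0 hpq fun a u ha hu =>
        (hv a u ha ((le_max_left _ _).trans hu)).2 hq⟩
  | small =>
    obtain ⟨v, hv0, hv⟩ := h'
    obtain ⟨e, he⟩ := hμ
    exact ⟨φ.powAbove p v, modularComparison_powAbove hv0 hp he,
      powAbove_lowerGrowth hv0 fun a u ha hu hau => (hv a u ha hu hau).1,
      fun hq => powAbove_upperGrowth hv0 hpq fun a u ha hu hau => (hv a u ha hu hau).2 hq⟩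

/-! ### The sufficient conditions in terms of the indices. -/

theorem exists_lowerGrowth_of_lt {r : ArgumentRange} {p : ℝ} (h : (p : EReal) < φ.lowerIndex r) :
    ∃ c : ℝ≥0, 0 < c ∧ r.Holds fun a u => c * a ^ p * φ u ≤ φ (a * u) := by
  obtain ⟨_, ⟨p', rfl, c, hc, hr⟩, hlt⟩ := lt_sSup_iff.1 h
  refine ⟨c, hc, hr.mono fun a u ha H => le_trans ?_ H⟩
  have : p ≤ p' := (EReal.coe_lt_coe_iff.1 hlt).le
  gcongr

theorem exists_upperGrowth_of_lt {r : ArgumentRange} {q : ℝ} (h : φ.upperIndex r < (q : EReal)) :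
    ∃ C : ℝ≥0, 0 < C ∧ r.Holds fun a u => φ (a * u) ≤ C * a ^ q * φ u := by
  obtain ⟨_, ⟨q', rfl, C, hC, hr⟩, hlt⟩ := sInf_lt_iff.1 h
  refine ⟨C, hC, hr.mono fun a u ha H => le_trans H ?_⟩
  have : q' ≤ q := (EReal.coe_lt_coe_iff.1 hlt).le
  gcongr

/-- The cap at 2 keeps `p` below every cotype exponent `s ≥ 2`; the power `u ^ p` used for the
extension then also obeys the upper growth condition with exponent `s`. -/
theorem exists_pos_lowerGrowth {r : ArgumentRange} (h : 0 < φ.lowerIndex r) :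
    ∃ p : ℝ, 0 < p ∧ p ≤ 2 ∧
      ∃ c : ℝ≥0, 0 < c ∧ r.Holds fun a u => c * a ^ p * φ u ≤ φ (a * u) := by
  obtain ⟨p, hp0, hp⟩ := EReal.lt_iff_exists_real_btwn.1 h
  have hp0' : 0 < p := by exact_mod_cast hp0
  refine ⟨min p 2, lt_min hp0' two_pos, min_le_right _ _, exists_lowerGrowth_of_lt ?_⟩
  exact lt_of_le_of_lt (EReal.coe_le_coe_iff.2 (min_le_left _ _)) hp

theorem hasCotype_of_upperIndex {r : ArgumentRange} (hμ : r.Matches μ)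
    (hα : 0 < φ.lowerIndex r) {ε : ℝ} (hε : 0 < ε) :
    HasCotype (φ.luxemburg μ) (max (φ.upperIndex r + ε) 2) := by
  obtain ⟨p, hp, hp2, c, hc, hlow⟩ := exists_pos_lowerGrowth hα
  rcases eq_or_ne (φ.upperIndex r) ⊤ with htop | htop
  · obtain ⟨ψ, hψ, hl, -⟩ := exists_modularComparison (C := 0) hμ hp le_rfl False hlow
      fun h => h.elim
    rw [htop, EReal.top_add_coe, max_eq_left le_top]
    exact hψ.hasCotype_top hl hc hp
  · obtain ⟨s, hs, hs2, hlt⟩ : ∃ s : ℝ, max (φ.upperIndex r + ε) 2 = (s : EReal) ∧ 2 ≤ s ∧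
        φ.upperIndex r < (s : EReal) := by
      generalize φ.upperIndex r = β at htop
      induction β with
      | bot => exact ⟨2, by rw [EReal.bot_add]; exact max_eq_right bot_le, le_rfl,
          EReal.bot_lt_coe _⟩
      | top => exact absurd rfl htop
      | coe β =>
        refine ⟨max (β + ε) 2, rfl, le_max_right _ _, ?_⟩
        exact EReal.coe_lt_coe_iff.2 (lt_max_of_lt_left (by linarith))
    obtain ⟨C, -, hup⟩ := exists_upperGrowth_of_lt hlt
    obtain ⟨ψ, hψ, hl, hu⟩ := exists_modularComparison hμ hp (hp2.trans hs2) True hlow fun _ => hup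
    rw [hs]
    exact hψ.hasCotype hl hc hp (hu trivial) hs2

theorem hasType_of_lowerIndex {r : ArgumentRange} (hμ : r.Matches μ)
    (hβ : φ.upperIndex r < ⊤) {ε : ℝ} (hε : 0 < ε) (hα : 0 < φ.lowerIndex r - ε) :
    HasType (φ.luxemburg μ) (min (φ.lowerIndex r - ε) 2).toReal := by
  obtain ⟨p, hpe, hp, hp2, hlt⟩ : ∃ p : ℝ, (min (φ.lowerIndex r - ε) 2).toReal = p ∧ 0 < p ∧
      p ≤ 2 ∧ (p : EReal) < φ.lowerIndex r := by
    generalize φ.lowerIndex r = α at hα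
    induction α with
    | bot => exact absurd hα (by simp)
    | top =>
      refine ⟨2, ?_, two_pos, le_rfl, EReal.coe_lt_top _⟩
      rw [EReal.top_sub_coe, min_eq_right le_top]
      rfl
    | coe α =>
      have hα' : 0 < α - ε := by exact_mod_cast hα
      refine ⟨min (α - ε) 2, ?_, lt_min hα' two_pos, min_le_right _ _,
        EReal.coe_lt_coe_iff.2 (min_lt_of_left_lt (by linarith))⟩
      rw [← EReal.coe_sub, ← EReal.toReal_coe (min (α - ε) 2)]
      congr 1
  obtain ⟨c, hc, hlow⟩ := exists_lowerGrowth_of_lt hlt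
  obtain ⟨q, hq⟩ := EReal.lt_iff_exists_real_btwn.1 hβ
  -- The upper exponent is raised to at least `p`, as the extension by a power requires.
  have hlt' : φ.upperIndex r < (max p q : ℝ) :=
    hq.1.trans_le (EReal.coe_le_coe_iff.2 (le_max_right _ _))
  obtain ⟨C, -, hup⟩ := exists_upperGrowth_of_lt hlt'
  obtain ⟨ψ, hψ, hl, hu⟩ := exists_modularComparison hμ hp (le_max_left p q) True hlow
    fun _ => hup
  rw [hpe]
  rcases le_total p 1 with hp1 | hp1
  · exact hψ.hasType_of_le_one hl hc hp hp1
  · exact hψ.hasType_of_one_le hl hc (hu trivial) hp1 hp2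

end OrliczFunction

/-! ### Disjoint cells of equal measure. -/

section Nonatomic

variable {Ω : Type*} [MeasurableSpace Ω] {μ : Measure Ω}

/-- A first splitting produces a part of finite measure; afterwards the smaller of two pieces has at
most half the measure, and this is iterated. -/
theorem MeasureTheory.Measure.IsNonatomic.exists_measure_le (hμ : μ.IsNonatomic) {A : Set Ω}
    (hA : MeasurableSet A) (h0 : 0 < μ A) {ε : ℝ≥0∞} (hε : 0 < ε) :
    ∃ C ⊆ A, MeasurableSet C ∧ 0 < μ C ∧ μ C ≤ ε := by
  obtain ⟨B, hBA, hB, hB0, hBlt⟩ := hμ A hA h0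
  have hBtop : μ B ≠ ∞ := (hBlt.trans_le le_top).ne
  have key : ∀ n : ℕ, ∃ C ⊆ B, MeasurableSet C ∧ 0 < μ C ∧ 2 ^ n * μ C ≤ μ B := by
    intro n
    induction n with
    | zero => exact ⟨B, subset_rfl, hB, hB0, by simp⟩
    | succ n ih =>
      obtain ⟨C, hCB, hC, hC0, hCle⟩ := ih
      obtain ⟨D, hDC, hD, hD0, hDlt⟩ := hμ C hC hC0
      have hsum : μ D + μ (C \ D) = μ C := by
        rw [← measure_sdiff_add_inter C hD, Set.inter_eq_right.2 hDC, add_comm]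
      have hdiff : 0 < μ (C \ D) := by
        rw [pos_iff_ne_zero]
        intro h
        rw [h, add_zero] at hsum
        exact hDlt.ne hsum
      rcases le_total (μ D) (μ (C \ D)) with h | h
      · refine ⟨D, hDC.trans hCB, hD, hD0, le_trans ?_ hCle⟩
        rw [pow_succ, mul_assoc, two_mul, ← hsum]
        gcongr
      · refine ⟨C \ D, Set.sdiff_subset.trans hCB, hC.diff hD, hdiff, le_trans ?_ hCle⟩
        rw [pow_succ, mul_assoc, two_mul, ← hsum]
        gcongr
  obtain ⟨n, hn⟩ := ENNReal.exists_nat_mul_gt hε.ne' hBtop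
  obtain ⟨C, hCB, hC, hC0, hCle⟩ := key n
  refine ⟨C, hCB.trans hBA, hC, hC0, ?_⟩
  have h1 : 2 ^ n * μ C < 2 ^ n * ε := by
    refine (hCle.trans_lt hn).trans_le ?_
    gcongr
    exact_mod_cast n.lt_two_pow_self.le
  exact (lt_of_mul_lt_mul_left' h1).le

/-- Sierpiński's theorem: a nonatomic measure attains all intermediate values. -/
theorem MeasureTheory.Measure.IsNonatomic.exists_measure_eq (hμ : μ.IsNonatomic) {A : Set Ω}
    (hA : MeasurableSet A) {t : ℝ≥0} (ht : t ≤ μ A) :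
    ∃ B ⊆ A, MeasurableSet B ∧ μ B = t := by
  let S := {B : Set Ω // B ⊆ A ∧ MeasurableSet B ∧ μ B ≤ t}
  -- Greedy enlargement: `B'` covers at least half of the gap between `μ B` and the supremum of the
  -- measures of admissible sets containing `B`, written without subtraction.
  have step : ∀ B : S, ∃ B' : S, B.1 ⊆ B'.1 ∧
      ∀ D : S, B.1 ⊆ D.1 → μ D.1 + μ B.1 ≤ 2 * μ B'.1 := by
    intro B
    set σ : ℝ≥0∞ := ⨆ D : {D : S // B.1 ⊆ D.1}, μ D.1.1 with hσ
    have hle : ∀ D : S, B.1 ⊆ D.1 → μ D.1 ≤ σ := fun D hD =>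
      le_iSup (fun D : {D : S // B.1 ⊆ D.1} => μ D.1.1) ⟨D, hD⟩
    have hσt : σ ≤ t := iSup_le fun D => D.1.2.2.2
    rcases (hle B subset_rfl).eq_or_lt with h | h
    · refine ⟨B, subset_rfl, fun D hD => ?_⟩
      rw [two_mul]
      exact add_le_add_left (by rw [h]; exact hle D hD) _
    · have hlt : (σ + μ B.1) / 2 < σ := by
        rw [ENNReal.div_lt_iff (Or.inl two_ne_zero) (Or.inl ENNReal.ofNat_ne_top), mul_two]
        exact ENNReal.add_lt_add_left (hσt.trans_lt ENNReal.coe_lt_top).ne h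
      obtain ⟨⟨B', hB'⟩, h'⟩ := lt_iSup_iff.1 hlt
      refine ⟨B', hB', fun D hD => ?_⟩
      rw [ENNReal.div_lt_iff (Or.inl two_ne_zero) (Or.inl ENNReal.ofNat_ne_top)] at h'
      rw [mul_comm]
      exact (add_le_add_left (hle D hD) _).trans h'.le
  choose f hf1 hf2 using step
  let B : ℕ → S := fun n => f^[n] ⟨∅, Set.empty_subset _, MeasurableSet.empty, by simp⟩
  have hBs : ∀ n, B (n + 1) = f (B n) := fun n => Function.iterate_succ_apply' f n _
  have hmono : Monotone fun n => (B n).1 := monotone_nat_of_le_succ fun n => by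
    change (B n).1 ⊆ (B (n + 1)).1
    rw [hBs]
    exact hf1 _
  have hsup : μ (⋃ n, (B n).1) = ⨆ n, μ (B n).1 := hmono.measure_iUnion
  have hBm : MeasurableSet (⋃ n, (B n).1) := MeasurableSet.iUnion fun n => (B n).2.2.1
  have hBA : (⋃ n, (B n).1) ⊆ A := Set.iUnion_subset fun n => (B n).2.1
  have hBt : μ (⋃ n, (B n).1) ≤ t := by rw [hsup]; exact iSup_le fun n => (B n).2.2.2
  refine ⟨_, hBA, hBm, hBt.antisymm (le_of_not_gt fun hlt => ?_)⟩
  have hne : μ (⋃ n, (B n).1) ≠ ∞ := (hlt.trans ENNReal.coe_lt_top).ne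
  have hpos : 0 < μ (A \ ⋃ n, (B n).1) := by
    rw [measure_sdiff hBA hBm.nullMeasurableSet hne]
    exact tsub_pos_of_lt (hlt.trans_le ht)
  obtain ⟨C, hCA, hC, hC0, hCle⟩ := hμ.exists_measure_le (hA.diff hBm) hpos
    (tsub_pos_of_lt hlt)
  have hdisj : Disjoint (⋃ n, (B n).1) C :=
    Set.disjoint_left.2 fun x hx hxC => (hCA hxC).2 hx
  have hDm : μ ((⋃ n, (B n).1) ∪ C) = μ (⋃ n, (B n).1) + μ C := measure_union hdisj hC
  let D : S := ⟨(⋃ n, (B n).1) ∪ C, Set.union_subset hBA (hCA.trans Set.sdiff_subset),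
    hBm.union hC, by
      rw [hDm]
      exact (add_le_add_right hCle _).trans (add_tsub_cancel_of_le hlt.le).le⟩
  -- The union enlarged by a small set is still admissible and contains every `B n`. In the limit
  -- the greedy inequality forces its measure not to exceed that of the union, although `C` has
  -- positive measure.
  have h1 : ∀ n, μ D.1 + μ (B n).1 ≤ 2 * μ (⋃ n, (B n).1) := by
    intro n
    refine (hf2 (B n) D ((Set.subset_iUnion (fun n => (B n).1) n).trans
      Set.subset_union_left)).trans ?_
    rw [← hBs]
    gcongr
    exact Set.subset_iUnion (fun n => (B n).1) (n + 1)
  have h2 : μ D.1 + μ (⋃ n, (B n).1) ≤ 2 * μ (⋃ n, (B n).1) := by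
    conv_lhs => rw [hsup, ENNReal.add_iSup]
    exact iSup_le h1
  rw [two_mul] at h2
  have h3 : μ D.1 ≤ μ (⋃ n, (B n).1) := (ENNReal.add_le_add_iff_right hne).1 h2
  change μ ((⋃ n, (B n).1) ∪ C) ≤ _ at h3
  rw [hDm] at h3
  exact absurd h3 (not_le.2 (ENNReal.lt_add_right hne hC0.ne'))

/-- There are disjoint measurable sets of measure `m` indexed by `ι`. -/
def HasCells (μ : Measure Ω) (ι : Type*) (m : ℝ≥0) : Prop :=
  ∃ A : ι → Set Ω, (∀ i, MeasurableSet (A i)) ∧ (∀ i j, i ≠ j → Disjoint (A i) (A j)) ∧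
    ∀ i, μ (A i) = m

theorem HasCells.of_equiv {ι κ : Type*} (e : ι ≃ κ) {m : ℝ≥0} (h : HasCells μ κ m) :
    HasCells μ ι m := by
  obtain ⟨A, h1, h2, h3⟩ := h
  exact ⟨fun i => A (e i), fun i => h1 _, fun i j hij => h2 _ _ (e.injective.ne hij),
    fun i => h3 _⟩

theorem MeasureTheory.Measure.IsNonatomic.hasCells (hμ : μ.IsNonatomic) (n : ℕ) {m : ℝ≥0}
    (h : ((n * m : ℝ≥0) : ℝ≥0∞) ≤ μ Set.univ) : HasCells μ (Fin n) m := by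
  have key : ∀ (n : ℕ) (A : Set Ω), MeasurableSet A → ((n * m : ℝ≥0) : ℝ≥0∞) ≤ μ A →
      ∃ B : Fin n → Set Ω, (∀ i, B i ⊆ A) ∧ (∀ i, MeasurableSet (B i)) ∧
        (∀ i j, i ≠ j → Disjoint (B i) (B j)) ∧ ∀ i, μ (B i) = m := by
    intro n
    induction n with
    | zero => exact fun A _ _ => ⟨fun _ => ∅, fun i => i.elim0, fun i => i.elim0,
        fun i => i.elim0, fun i => i.elim0⟩
    | succ n ih =>
      intro A hA hle
      have hle' : ((n * m : ℝ≥0) : ℝ≥0∞) + (m : ℝ≥0∞) ≤ μ A := by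
        refine le_trans (le_of_eq ?_) hle
        push_cast
        ring
      obtain ⟨C, hCA, hC, hCm⟩ := hμ.exists_measure_eq hA (le_trans le_add_self hle')
      have hdiff : ((n * m : ℝ≥0) : ℝ≥0∞) ≤ μ (A \ C) := by
        rw [measure_sdiff hCA hC.nullMeasurableSet (by rw [hCm]; exact ENNReal.coe_ne_top), hCm]
        exact ENNReal.le_sub_of_add_le_right ENNReal.coe_ne_top hle'
      obtain ⟨B, hBA, hB, hdisj, hBm⟩ := ih (A \ C) (hA.diff hC) hdiff
      have hCB : ∀ i, Disjoint C (B i) := fun i =>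
        Set.disjoint_left.2 fun x hx hxB => (hBA i hxB).2 hx
      refine ⟨Fin.cons C B, fun i => ?_, fun i => ?_, fun i j => ?_, fun i => ?_⟩
      · refine Fin.cases ?_ (fun i => ?_) i
        · simpa using hCA
        · simpa using (hBA i).trans Set.sdiff_subset
      · refine Fin.cases ?_ (fun i => ?_) i
        · simpa using hC
        · simpa using hB i
      · refine Fin.cases ?_ (fun i => ?_) i <;> refine Fin.cases ?_ (fun j => ?_) j
        · intro h; exact absurd rfl h
        · intro _; simpa using hCB j
        · intro _; simpa using (hCB i).symm
        · intro h; simpa using hdisj i j (fun h' => h (by rw [h']))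
      · refine Fin.cases ?_ (fun i => ?_) i
        · simpa using hCm
        · simpa using hBm i
  obtain ⟨B, -, hB⟩ := key n Set.univ MeasurableSet.univ h
  exact ⟨B, hB⟩

theorem hasCells_of_measurePreserving_count {e : Ω ≃ᵐ ℕ}
    (he : MeasurePreserving e μ Measure.count) (n j : ℕ) : HasCells μ (Fin n) j := by
  refine ⟨fun k => e ⁻¹' (Finset.Ico (k * j) ((k + 1) * j) : Finset ℕ),
    fun k => e.measurable (Finset.measurableSet _), fun k l hkl => ?_, fun k => ?_⟩
  · refine Disjoint.preimage _ (Set.disjoint_left.2 fun x hx hy => hkl ?_)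
    simp only [Finset.coe_Ico, Set.mem_Ico] at hx hy
    have h1 : (k : ℕ) < l + 1 := lt_of_mul_lt_mul_right (hx.1.trans_lt hy.2) (Nat.zero_le j)
    have h2 : (l : ℕ) < k + 1 := lt_of_mul_lt_mul_right (hy.1.trans_lt hx.2) (Nat.zero_le j)
    exact Fin.ext (by omega)
  · rw [he.measure_preimage (Finset.measurableSet _).nullMeasurableSet, Measure.count_apply_finset]
    simp [add_mul]

/-- The values `τ` for which there are `n` disjoint cells of measure about `1 / τ`. -/
def ArgumentRange.Admits (r : ArgumentRange) (μ : Measure Ω) (n : ℕ) (τ : ℝ≥0) : Prop :=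
  match r with
  | .all => True
  | .large => (n : ℝ≥0∞) ≤ μ Set.univ * τ
  | .small => τ ≤ 1

/-- With `τ` the value of `φ`, or of `n φ`, at a test argument, the corresponding modular `m τ` lies
between `1 / 2` and 1. Exactly `m = 1 / τ` works on nonatomic spaces; the factor 2 pays for integer
masses. -/
theorem ArgumentRange.Matches.exists_hasCells {r : ArgumentRange} (hμ : r.Matches μ) {n : ℕ}
    {τ : ℝ≥0} (hτ : 0 < τ) (h : r.Admits μ n τ) :
    ∃ m : ℝ≥0, 0 < m ∧ HasCells μ (Fin n) m ∧ m * τ ≤ 1 ∧ 1 ≤ 2 * (m * τ) := by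
  have h1 : τ⁻¹ * τ ≤ 1 ∧ 1 ≤ 2 * (τ⁻¹ * τ) := by
    rw [inv_mul_cancel₀ hτ.ne']; norm_num
  cases r with
  | all =>
    exact ⟨τ⁻¹, inv_pos.2 hτ, hμ.2.1.hasCells n (by rw [hμ.2.2]; exact le_top), h1⟩
  | large =>
    refine ⟨τ⁻¹, inv_pos.2 hτ, hμ.1.hasCells n ?_, h1⟩
    change (n : ℝ≥0∞) ≤ μ Set.univ * τ at h
    rw [ENNReal.coe_mul, ENNReal.coe_inv hτ.ne', ← div_eq_mul_inv]
    refine ENNReal.div_le_of_le_mul ?_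
    exact_mod_cast h
  | small =>
    obtain ⟨e, he⟩ := hμ
    change τ ≤ 1 at h
    -- As `τ⁻¹ ≥ 1`, rounding down loses at most a factor 2.
    have hone : 1 ≤ ⌊τ⁻¹⌋₊ := Nat.one_le_floor_iff _ |>.2 ((one_le_inv₀ hτ).2 h)
    have hone' : (1 : ℝ≥0) ≤ (⌊τ⁻¹⌋₊ : ℝ≥0) := by exact_mod_cast hone
    refine ⟨⌊τ⁻¹⌋₊, by exact_mod_cast hone, hasCells_of_measurePreserving_count he n _, ?_, ?_⟩
    · refine le_trans ?_ h1.1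
      gcongr
      exact Nat.floor_le zero_le
    · have h2 : τ⁻¹ ≤ 2 * (⌊τ⁻¹⌋₊ : ℝ≥0) := by
        refine (Nat.lt_floor_add_one τ⁻¹).le.trans ?_
        rw [two_mul]
        gcongr
      rw [← mul_assoc, ← inv_le_iff_one_le_mul₀ hτ]
      exact h2

end Nonatomic

/-! ### Test vectors made of step functions. -/

/-- The step function with value `c i` on `A i`. -/
noncomputable def stepFun {Ω ι : Type*} [Fintype ι] (A : ι → Set Ω) (c : ι → ℝ) (t : Ω) : ℝ :=
  ∑ i, (A i).indicator (fun _ => c i) t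

theorem signedSum_stepFun {Ω ι : Type*} [Fintype ι] (A : ι → Set Ω) {n : ℕ}
    (c : Fin n → ι → ℝ) (ε : Fin n → Bool) (t : Ω) :
    signedSum (fun k => stepFun A (c k) t) ε =
      stepFun A (fun i => signedSum (fun k => c k i) ε) t := by
  simp only [signedSum, stepFun, Finset.mul_sum]
  rw [Finset.sum_comm]
  refine Finset.sum_congr rfl fun i _ => ?_
  by_cases h : t ∈ A i <;> simp [h]

section StepFunctions

variable {Ω : Type*} [MeasurableSpace Ω] {μ : Measure Ω} {ι : Type*} [Fintype ι]

theorem measurable_stepFun {A : ι → Set Ω} (hA : ∀ i, MeasurableSet (A i)) (c : ι → ℝ) :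
    Measurable (stepFun A c) :=
  Finset.measurable_fun_sum _ fun i _ => measurable_const.indicator (hA i)

namespace OrliczFunction

variable {φ : OrliczFunction}

theorem lintegral_stepFun {A : ι → Set Ω} (hA : ∀ i, MeasurableSet (A i))
    (hd : ∀ i j, i ≠ j → Disjoint (A i) (A j)) {m : ℝ≥0} (hm : ∀ i, μ (A i) = m) (c : ι → ℝ)
    (s : ℝ≥0) :
    ∫⁻ t, (φ (s * ‖stepFun A c t‖₊) : ℝ≥0∞) ∂μ = ((m * ∑ i, φ (s * ‖c i‖₊) : ℝ≥0) : ℝ≥0∞) := by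
  have key : ∀ t, (φ (s * ‖stepFun A c t‖₊) : ℝ≥0∞) =
      ∑ i, (A i).indicator (fun _ => (φ (s * ‖c i‖₊) : ℝ≥0∞)) t := by
    intro t
    by_cases ht : ∃ j, t ∈ A j
    · obtain ⟨j, hj⟩ := ht
      have hne : ∀ i, i ≠ j → t ∉ A i := fun i hi hti => Set.disjoint_left.1 (hd i j hi) hti hj
      unfold stepFun
      rw [Fintype.sum_eq_single j fun i hi => Set.indicator_of_notMem (hne i hi) _,
        Fintype.sum_eq_single j fun i hi => Set.indicator_of_notMem (hne i hi) _,
        Set.indicator_of_mem hj, Set.indicator_of_mem hj]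
    · simp only [not_exists] at ht
      simp [stepFun, ht, φ.map_zero]
  simp only [key]
  rw [lintegral_finsetSum _ fun i _ => measurable_const.indicator (hA i)]
  simp only [lintegral_indicator_const (hA _), hm]
  push_cast
  rw [← Finset.sum_mul, mul_comm]

theorem exists_step_vector {A : ι → Set Ω} (hA : ∀ i, MeasurableSet (A i))
    (hd : ∀ i j, i ≠ j → Disjoint (A i) (A j)) {m : ℝ≥0} (hm : ∀ i, μ (A i) = m) (c : ι → ℝ) :
    ∃ x : φ.space μ, (x : Ω →ₘ[μ] ℝ) =ᵐ[μ] stepFun A c := by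
  refine ⟨spaceMk φ μ _ (measurable_stepFun hA c) ?_, coeFn_spaceMk _ _⟩
  have h := lintegral_stepFun (φ := φ) hA hd hm c 1
  simp only [one_mul] at h
  rw [h]
  exact ENNReal.coe_lt_top

theorem luxemburg_step_le {A : ι → Set Ω} (hA : ∀ i, MeasurableSet (A i))
    (hd : ∀ i j, i ≠ j → Disjoint (A i) (A j)) {m : ℝ≥0} (hm : ∀ i, μ (A i) = m) {c : ι → ℝ}
    {x : φ.space μ} (hx : (x : Ω →ₘ[μ] ℝ) =ᵐ[μ] stepFun A c)
    (h : m * ∑ i, φ ‖c i‖₊ ≤ 1) : φ.luxemburg μ x ≤ 1 := by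
  refine luxemburg_le one_pos hx ?_
  rw [lintegral_stepFun hA hd hm]
  simpa only [inv_one, one_mul, ENNReal.coe_le_one_iff] using h

theorem le_luxemburg_step {A : ι → Set Ω} (hA : ∀ i, MeasurableSet (A i))
    (hd : ∀ i j, i ≠ j → Disjoint (A i) (A j)) {m : ℝ≥0} (hm : ∀ i, μ (A i) = m) {c : ι → ℝ}
    {x : φ.space μ} (hx : (x : Ω →ₘ[μ] ℝ) =ᵐ[μ] stepFun A c) {s : ℝ≥0}
    (h : 1 < m * ∑ i, φ (s⁻¹ * ‖c i‖₊)) : (s : ℝ) ≤ φ.luxemburg μ x := by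
  refine le_of_not_gt fun hlt => absurd h (not_lt.2 ?_)
  have := modular_le_one_of_lt hlt hx
  rwa [lintegral_stepFun hA hd hm, ENNReal.coe_le_one_iff] at this

theorem signedSum_single {n : ℕ} (w : ℝ) (i : Fin n) (ε : Fin n → Bool) :
    signedSum (fun k => (Pi.single k w : Fin n → ℝ) i) ε = boolSign (ε i) * w := by
  unfold signedSum
  rw [Fintype.sum_eq_single i fun k hk => by simp [hk.symm]]
  simp

/-- The lower `q`-estimate for disjoint functions that follows from cotype `q`. -/
theorem cotype_disjoint {q K : ℝ} (hq : 0 < q) (hK : 0 < K)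
    (h : ∀ (n : ℕ) (x : Fin n → φ.space μ),
      lqSum (q : EReal) (fun k => φ.luxemburg μ (x k)) ≤ K * rademacherAverage (φ.luxemburg μ) x)
    {n : ℕ} {m w : ℝ≥0} (hcells : HasCells μ (Fin n) m)
    (hw : m * (n * φ w) ≤ 1) {b : ℝ≥0} (hb : (2 * K * b) ^ q ≤ n * (w : ℝ) ^ q) :
    m * φ b ≤ 1 := by
  obtain ⟨A, hA, hd, hm⟩ := hcells
  -- The vectors are `w` times the indicators of the cells, so all signed sums have modular `m n
  -- φ(w) ≤ 1`. If `m φ(b) > 1`, each vector has norm at least `w / b`, and cotype gives `n (w / b)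
  -- ^ q ≤ K ^ q`, which the factor 2 in `hb` excludes.
  choose x hx using fun k : Fin n =>
    exists_step_vector (φ := φ) hA hd hm (Pi.single k (w : ℝ))
  have havg : rademacherAverage (φ.luxemburg μ) x ≤ 1 := by
    refine rademacherAverage_le fun ε => luxemburg_step_le hA hd hm
      (c := fun i => signedSum (fun k => (Pi.single k (w : ℝ) : Fin n → ℝ) i) ε) ?_ ?_
    · refine (coeFn_signedSum x hx ε).trans (Eventually.of_forall fun t => ?_)
      exact signedSum_stepFun A _ ε t
    · simp only [signedSum_single, nnnorm_mul, nnnorm_boolSign, NNReal.nnnorm_eq, one_mul]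
      simpa using hw
  by_contra! hlt
  have hb0 : 0 < b := by
    rcases eq_or_ne b 0 with rfl | hb0
    · simp [φ.map_zero] at hlt
    · exact pos_iff_ne_zero.2 hb0
  have hn : n ≠ 0 := by
    rintro rfl
    have : 0 < (2 * K * b) ^ q := Real.rpow_pos_of_pos (by positivity) _
    simp at hb
    linarith
  have hw0 : 0 < w := by
    rcases eq_or_ne w 0 with rfl | hw0
    · have : 0 < (2 * K * b) ^ q := Real.rpow_pos_of_pos (by positivity) _
      simp [Real.zero_rpow hq.ne'] at hb
      linarith
    · exact pos_iff_ne_zero.2 hw0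
  set s : ℝ≥0 := w / b with hs
  have hN : ∀ k, (s : ℝ) ≤ φ.luxemburg μ (x k) := fun k => by
    refine le_luxemburg_step hA hd hm (hx k) ?_
    have e : s⁻¹ * ‖(w : ℝ)‖₊ = b := by
      rw [NNReal.nnnorm_eq, hs, inv_div, div_mul_cancel₀ _ hw0.ne']
    rw [Fintype.sum_eq_single k fun i hi => by simp [hi, φ.map_zero],
      Pi.single_eq_same, e]
    exact hlt
  have h1 := (h n x).trans (mul_le_of_le_one_right hK.le havg)
  rw [lqSum, if_neg (EReal.coe_ne_top q), EReal.toReal_coe, one_div,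
    Real.rpow_inv_le_iff_of_pos (Finset.sum_nonneg fun k _ =>
      Real.rpow_nonneg (luxemburg_nonneg _) _) hK.le hq] at h1
  have h2 : n * (s : ℝ) ^ q ≤ K ^ q := by
    refine le_trans ?_ h1
    calc n * (s : ℝ) ^ q = ∑ k : Fin n, (s : ℝ) ^ q := by simp
      _ ≤ _ := Finset.sum_le_sum fun k _ => Real.rpow_le_rpow s.2 (hN k) hq.le
  have hb0' : (0 : ℝ) < b := hb0
  have h3 : (2 * K) ^ q ≤ K ^ q := by
    refine le_trans ?_ h2
    rw [hs, NNReal.coe_div, Real.div_rpow w.coe_nonneg b.coe_nonneg, ← mul_div_assoc,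
      le_div_iff₀ (Real.rpow_pos_of_pos hb0' _), ← Real.mul_rpow (by positivity) b.coe_nonneg]
    exact hb
  rw [Real.rpow_le_rpow_iff (by positivity) hK.le hq] at h3
  linarith

/-- The upper `p`-estimate for disjoint functions that follows from type `p`. -/
theorem type_disjoint {p K : ℝ} (hp : 0 < p) (hK : 0 < K)
    (h : ∀ (n : ℕ) (x : Fin n → φ.space μ), rademacherAverage (φ.luxemburg μ) x ≤
      K * (∑ k, φ.luxemburg μ (x k) ^ p) ^ (1 / p))
    {n : ℕ} {m w : ℝ≥0} (hn : n ≠ 0) (hcells : HasCells μ (Fin n) m)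
    (hw : m * φ w ≤ 1) {b : ℝ≥0} (hb : n * (2 * K * b) ^ p ≤ (w : ℝ) ^ p) :
    m * (n * φ b) ≤ 1 := by
  obtain ⟨A, hA, hd, hm⟩ := hcells
  -- Dually, each vector now has norm at most 1, while failure of the conclusion would give every
  -- signed sum norm at least `w / b ≥ 2 K n ^ (1 / p)`, twice what type `p` allows.
  choose x hx using fun k : Fin n =>
    exists_step_vector (φ := φ) hA hd hm (Pi.single k (w : ℝ))
  have hN : ∀ k, φ.luxemburg μ (x k) ≤ 1 := fun k => by
    refine luxemburg_step_le hA hd hm (hx k) ?_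
    rw [Fintype.sum_eq_single k fun i hi => by simp [hi, φ.map_zero],
      Pi.single_eq_same, NNReal.nnnorm_eq]
    exact hw
  have hsum : ∑ k, φ.luxemburg μ (x k) ^ p ≤ n := by
    calc _ ≤ ∑ k : Fin n, (1 : ℝ) := Finset.sum_le_sum fun k _ =>
          Real.rpow_le_one (luxemburg_nonneg _) (hN k) hp.le
      _ = n := by simp
  have havg : rademacherAverage (φ.luxemburg μ) x ≤ K * (n : ℝ) ^ p⁻¹ := by
    refine (h n x).trans ?_
    rw [one_div]
    have h0 : 0 ≤ ∑ k, φ.luxemburg μ (x k) ^ p := Finset.sum_nonneg fun k _ =>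
      Real.rpow_nonneg (luxemburg_nonneg _) _
    gcongr
  by_contra! hlt
  have hb0 : 0 < b := by
    rcases eq_or_ne b 0 with rfl | hb0
    · simp [φ.map_zero] at hlt
    · exact pos_iff_ne_zero.2 hb0
  have hn0 : (0 : ℝ) < n := by exact_mod_cast Nat.pos_of_ne_zero hn
  have hw0 : 0 < w := by
    rcases eq_or_ne w 0 with rfl | hw0
    · have : 0 < n * (2 * K * b) ^ p :=
        mul_pos hn0 (Real.rpow_pos_of_pos (by positivity) _)
      simp [Real.zero_rpow hp.ne'] at hb
      linarith
    · exact pos_iff_ne_zero.2 hw0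
  set s : ℝ≥0 := w / b with hs
  have hS : (s : ℝ) ≤ rademacherAverage (φ.luxemburg μ) x := by
    refine le_rademacherAverage fun ε => le_luxemburg_step hA hd hm
      (c := fun i => signedSum (fun k => (Pi.single k (w : ℝ) : Fin n → ℝ) i) ε) ?_ ?_
    · refine (coeFn_signedSum x hx ε).trans (Eventually.of_forall fun t => ?_)
      exact signedSum_stepFun A _ ε t
    · have e : s⁻¹ * w = b := by
        rw [hs, inv_div, div_mul_cancel₀ _ hw0.ne']
      simp only [signedSum_single, nnnorm_mul, nnnorm_boolSign, NNReal.nnnorm_eq, one_mul, e]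
      simpa using hlt
  have hb0' : (0 : ℝ) < b := hb0
  have h1 : 2 * K * (n : ℝ) ^ p⁻¹ ≤ s := by
    rw [hs, NNReal.coe_div, le_div_iff₀ hb0', ← Real.rpow_le_rpow_iff (by positivity) w.coe_nonneg hp]
    refine le_trans (le_of_eq ?_) hb
    rw [show 2 * K * (n : ℝ) ^ p⁻¹ * b = (n : ℝ) ^ p⁻¹ * (2 * K * b) by ring,
      Real.mul_rpow (by positivity) (by positivity), Real.rpow_inv_rpow hn0.le hp.ne']
  have h2 : 0 < K * (n : ℝ) ^ p⁻¹ := mul_pos hK (Real.rpow_pos_of_pos hn0 _)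
  linarith

/-- Type `p > 1` gives a doubling inequality: embed the Rademacher vectors of `ℓ_∞`. -/
theorem type_doubling {p K : ℝ} (hp : 0 < p)
    (h : ∀ (n : ℕ) (x : Fin n → φ.space μ), rademacherAverage (φ.luxemburg μ) x ≤
      K * (∑ k, φ.luxemburg μ (x k) ^ p) ^ (1 / p)) (hK : 0 < K)
    {n : ℕ} (hn : 2 * K * (n : ℝ) ^ p⁻¹ < n)
    {m w : ℝ≥0} (hcells : HasCells μ (Fin (2 ^ n)) m) (hw : m * (2 ^ n * φ w) ≤ 1) :
    m * φ (2 * w) ≤ 1 := by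
  obtain ⟨A, hA, hd, hm⟩ := hcells.of_equiv (ι := Fin n → Bool)
    (Fintype.equivFinOfCardEq (by simp))
  -- Cells are indexed by sign patterns, and `x_k` equals `w` times the `k`-th sign of the pattern.
  -- All `|x_k|` are equal, of norm at most 1; the sum with signs `ε` equals `n w` on the cell `ε`,
  -- so its norm would be at least `n / 2` if `m φ(2 w) > 1`.
  choose x hx using fun k : Fin n =>
    exists_step_vector (φ := φ) hA hd hm (fun δ => boolSign (δ k) * (w : ℝ))
  have hN : ∀ k, φ.luxemburg μ (x k) ≤ 1 := fun k => by
    refine luxemburg_step_le hA hd hm (hx k) ?_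
    simp only [nnnorm_mul, nnnorm_boolSign, NNReal.nnnorm_eq, one_mul]
    simpa using hw
  have hsum : ∑ k, φ.luxemburg μ (x k) ^ p ≤ n := by
    calc _ ≤ ∑ k : Fin n, (1 : ℝ) := Finset.sum_le_sum fun k _ =>
          Real.rpow_le_one (luxemburg_nonneg _) (hN k) hp.le
      _ = n := by simp
  have havg : rademacherAverage (φ.luxemburg μ) x ≤ K * (n : ℝ) ^ p⁻¹ := by
    refine (h n x).trans ?_
    rw [one_div]
    have h0 : 0 ≤ ∑ k, φ.luxemburg μ (x k) ^ p := Finset.sum_nonneg fun k _ =>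
      Real.rpow_nonneg (luxemburg_nonneg _) _
    gcongr
  by_contra! hlt
  have hn0 : (0 : ℝ) < n := lt_of_le_of_lt (by positivity) hn
  have hn0' : (0 : ℝ≥0) < n := by exact_mod_cast hn0
  have hS : (((n : ℝ≥0) / 2 : ℝ≥0) : ℝ) ≤ rademacherAverage (φ.luxemburg μ) x := by
    refine le_rademacherAverage fun ε => le_luxemburg_step hA hd hm
      (c := fun δ => signedSum (fun k => boolSign (δ k) * (w : ℝ)) ε) ?_ ?_
    · refine (coeFn_signedSum x hx ε).trans (Eventually.of_forall fun t => ?_)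
      exact signedSum_stepFun A _ ε t
    · have e : signedSum (fun k => boolSign (ε k) * (w : ℝ)) ε = n * w := by
        have : ∀ b, boolSign b * (boolSign b * (w : ℝ)) = w := fun b => by cases b <;> simp
        simp [signedSum, this]
      have e' : ((n : ℝ≥0) / 2)⁻¹ * ‖signedSum (fun k => boolSign (ε k) * (w : ℝ)) ε‖₊ = 2 * w := by
        rw [e, nnnorm_mul, NNReal.nnnorm_eq, Real.nnnorm_natCast, inv_div]
        field_simp
      have hle := Finset.sum_le_univ_sum_of_nonneg (s := {ε})
        (f := fun δ : Fin n → Bool => φ (((n : ℝ≥0) / 2)⁻¹ *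
          ‖signedSum (fun k => boolSign (δ k) * (w : ℝ)) ε‖₊)) fun _ => zero_le
      rw [Finset.sum_singleton, e'] at hle
      exact hlt.trans_le (mul_le_mul_right hle m)
  push_cast at hS
  linarith

end OrliczFunction

end StepFunctions

/-! ### Necessity of the conditions on the exponents. -/

theorem le_of_forall_natCast_rpow_le {a b K : ℝ}
    (h : ∀ n : ℕ, 1 ≤ n → (n : ℝ) ^ a ≤ K * (n : ℝ) ^ b) : a ≤ b := by
  by_contra! hlt
  have ht : Tendsto (fun n : ℕ => (n : ℝ) ^ (a - b)) atTop atTop :=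
    (tendsto_rpow_atTop (sub_pos.2 hlt)).comp tendsto_natCast_atTop_atTop
  obtain ⟨n, hn, hK⟩ := ((eventually_ge_atTop 1).and (ht.eventually_gt_atTop K)).exists
  have hn0 : (0 : ℝ) < n := by exact_mod_cast hn
  rw [Real.rpow_sub hn0, lt_div_iff₀ (Real.rpow_pos_of_pos hn0 _)] at hK
  exact absurd (h n hn) (not_le.2 hK)

theorem ArgumentRange.Matches.exists_one_cell {Ω : Type*} [MeasurableSpace Ω] {μ : Measure Ω}
    {r : ArgumentRange} (hμ : r.Matches μ) : ∃ m : ℝ≥0, 0 < m ∧ HasCells μ (Fin 1) m := by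
  obtain ⟨τ, hτ, h⟩ : ∃ τ : ℝ≥0, 0 < τ ∧ r.Admits μ 1 τ := by
    cases r with
    | all => exact ⟨1, one_pos, trivial⟩
    | large =>
      have hM := ENNReal.coe_toNNReal hμ.2.2.ne
      have hM0 : 0 < (μ Set.univ).toNNReal := ENNReal.toNNReal_pos hμ.2.1.ne' hμ.2.2.ne
      refine ⟨(μ Set.univ).toNNReal⁻¹, inv_pos.2 hM0, ?_⟩
      change ((1 : ℕ) : ℝ≥0∞) ≤ _
      rw [ENNReal.coe_inv hM0.ne', hM, Nat.cast_one,
        ENNReal.mul_inv_cancel hμ.2.1.ne' hμ.2.2.ne]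
    | small => exact ⟨1, one_pos, le_refl (1 : ℝ≥0)⟩
  obtain ⟨m, hm, hc, -⟩ := hμ.exists_hasCells hτ h
  exact ⟨m, hm, hc⟩

namespace OrliczFunction

variable {Ω : Type*} [MeasurableSpace Ω] {φ : OrliczFunction} {μ : Measure Ω}

theorem exists_luxemburg_pos {r : ArgumentRange} (hμ : r.Matches μ) :
    ∃ x : φ.space μ, 0 < φ.luxemburg μ x := by
  obtain ⟨m, hm0, A, hA, hd, hm⟩ := hμ.exists_one_cell
  obtain ⟨x, hx⟩ := exists_step_vector (φ := φ) hA hd hm (fun _ => 1)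
  obtain ⟨u, hu, hu0⟩ := ((φ.tendsto_atTop.eventually_gt_atTop m⁻¹).and
    (eventually_gt_atTop 0)).exists
  refine ⟨x, lt_of_lt_of_le ?_ (le_luxemburg_step hA hd hm hx (s := u⁻¹) ?_)⟩
  · exact_mod_cast inv_pos.2 hu0
  · rw [inv_lt_iff_one_lt_mul₀ hm0] at hu
    simpa [mul_comm] using hu

theorem rademacherAverage_const (x : φ.space μ) (n : ℕ) :
    rademacherAverage (φ.luxemburg μ) (fun _ : Fin n => x) =
      ((2 ^ n : ℝ)⁻¹ * ∑ ε : Fin n → Bool, |signedSum (fun _ => 1) ε|) * φ.luxemburg μ x := by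
  rw [rademacherAverage_eq, mul_assoc, Finset.sum_mul]
  congr 1
  refine Finset.sum_congr rfl fun ε _ => ?_
  rw [← Finset.sum_smul, luxemburg_smul]
  simp [signedSum]

theorem sum_abs_signedSum_one_le (n : ℕ) :
    (2 ^ n : ℝ)⁻¹ * ∑ ε : Fin n → Bool, |signedSum (fun _ => 1) ε| ≤ √n := by
  rw [inv_mul_le_iff₀ (by positivity)]
  have h1 : (∑ ε : Fin n → Bool, |signedSum (fun _ => 1) ε|) ^ 2 ≤ (2 ^ n * √n) ^ 2 := by
    refine (sq_sum_le_card_mul_sum_sq (s := Finset.univ)).trans ?_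
    simp only [sq_abs, sum_signedSum_sq, mul_pow, Real.sq_sqrt (Nat.cast_nonneg n)]
    refine le_of_eq ?_
    simp
    ring
  exact le_of_sq_le_sq h1 (by positivity)

/-- By Paley-Zygmund, `|S| ≥ √n / 2` for at least the fraction `3 / 14` of the signs. -/
theorem le_sum_abs_signedSum_one (n : ℕ) :
    3 / 28 * √n ≤ (2 ^ n : ℝ)⁻¹ * ∑ ε : Fin n → Bool, |signedSum (fun _ => 1) ε| := by
  rw [le_inv_mul_iff₀ (by positivity)]
  classical
  set H := Finset.univ.filter fun ε : Fin n → Bool =>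
    ∑ k : Fin n, (1 : ℝ) ^ 2 ≤ 4 * signedSum (fun _ => 1) ε ^ 2 with hH
  have hc := card_signedSum_ge (fun _ : Fin n => (1 : ℝ))
  rw [← hH] at hc
  have h1 : ∀ ε ∈ H, √n / 2 ≤ |signedSum (fun _ : Fin n => (1 : ℝ)) ε| := by
    intro ε hε
    have h2 : (n : ℝ) ≤ 4 * signedSum (fun _ : Fin n => (1 : ℝ)) ε ^ 2 := by simpa [hH] using hε
    refine le_of_sq_le_sq ?_ (abs_nonneg _)
    rw [div_pow, Real.sq_sqrt (Nat.cast_nonneg n), sq_abs]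
    linarith
  calc (2 : ℝ) ^ n * (3 / 28 * √n) = 2 ^ n * (3 / 14) * (√n / 2) := by ring
    _ ≤ H.card * (√n / 2) := by gcongr
    _ = ∑ ε ∈ H, √n / 2 := by simp
    _ ≤ ∑ ε ∈ H, |signedSum (fun _ : Fin n => (1 : ℝ)) ε| := Finset.sum_le_sum h1
    _ ≤ _ := Finset.sum_le_univ_sum_of_nonneg fun ε => abs_nonneg _

/-- For a constant family the average is at most `√n ‖x‖`, whereas the `ℓ_q` sum is `n ^ (1 / q)
‖x‖`. -/
theorem two_le_of_hasCotype {r : ArgumentRange} (hμ : r.Matches μ) {q : ℝ}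
    (h : HasCotype (φ.luxemburg μ) (q : EReal)) : 2 ≤ q := by
  obtain ⟨hq, K, hK, h⟩ := h
  have hq0 : 0 < q := by exact_mod_cast hq
  obtain ⟨x, hx⟩ := exists_luxemburg_pos (φ := φ) hμ
  have key : q⁻¹ ≤ 2⁻¹ := by
    refine le_of_forall_natCast_rpow_le (K := K) fun n hn => ?_
    have h1 := h n fun _ => x
    rw [lqSum, if_neg (EReal.coe_ne_top q), EReal.toReal_coe, rademacherAverage_const] at h1
    have h2 : (∑ k : Fin n, φ.luxemburg μ x ^ q) ^ (1 / q) =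
        (n : ℝ) ^ q⁻¹ * φ.luxemburg μ x := by
      rw [Finset.sum_const, Finset.card_univ, Fintype.card_fin, nsmul_eq_mul, one_div,
        Real.mul_rpow (Nat.cast_nonneg n) (Real.rpow_nonneg hx.le _),
        Real.rpow_rpow_inv hx.le hq0.ne']
    rw [h2, ← mul_assoc] at h1
    refine (le_of_mul_le_mul_right h1 hx).trans ?_
    rw [← one_div 2, ← Real.sqrt_eq_rpow]
    gcongr
    exact sum_abs_signedSum_one_le n
  exact (inv_le_inv₀ hq0 two_pos).1 key

/-- Constant families again, now with the lower bound of order `√n` for the scalar average. -/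
theorem le_two_of_hasType {r : ArgumentRange} (hμ : r.Matches μ) {p : ℝ}
    (h : HasType (φ.luxemburg μ) p) : p ≤ 2 := by
  obtain ⟨hp, K, hK, h⟩ := h
  obtain ⟨x, hx⟩ := exists_luxemburg_pos (φ := φ) hμ
  have key : 2⁻¹ ≤ p⁻¹ := by
    refine le_of_forall_natCast_rpow_le (K := 28 / 3 * K) fun n hn => ?_
    have h1 := h n fun _ => x
    rw [rademacherAverage_const] at h1
    have h2 : (∑ k : Fin n, φ.luxemburg μ x ^ p) ^ (1 / p) =
        (n : ℝ) ^ p⁻¹ * φ.luxemburg μ x := by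
      rw [Finset.sum_const, Finset.card_univ, Fintype.card_fin, nsmul_eq_mul, one_div,
        Real.mul_rpow (Nat.cast_nonneg n) (Real.rpow_nonneg hx.le _),
        Real.rpow_rpow_inv hx.le hp.ne']
    rw [h2, ← mul_assoc] at h1
    have h3 := (le_sum_abs_signedSum_one n).trans (le_of_mul_le_mul_right h1 hx)
    rw [← one_div 2, ← Real.sqrt_eq_rpow]
    linarith
  exact (inv_le_inv₀ two_pos hp).1 key

theorem le_of_mul_le_one {m x y : ℝ≥0} (hm : 0 < m) (hx : m * x ≤ 1) (hy : 1 ≤ 2 * (m * y)) :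
    x ≤ 2 * y := by
  refine le_of_mul_le_mul_left (hx.trans (hy.trans (le_of_eq ?_))) hm
  ring

/-- Above `v`, and for every `n ≥ 1`, there is room in the space for `n` cells of measure `1 / (n
φ(u))`. -/
theorem exists_forall_ge_one_le (φ : OrliczFunction) (hμ0 : 0 < μ Set.univ)
    (hμ : μ Set.univ < ∞) :
    ∃ v : ℝ≥0, 0 < v ∧ ∀ u, v ≤ u → 1 < μ Set.univ * φ u := by
  have hM := ENNReal.coe_toNNReal hμ.ne
  have hM0 : 0 < (μ Set.univ).toNNReal := ENNReal.toNNReal_pos hμ0.ne' hμ.ne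
  obtain ⟨v, hv, hv0⟩ := ((φ.tendsto_atTop.eventually_gt_atTop (μ Set.univ).toNNReal⁻¹).and
    (eventually_gt_atTop 0)).exists
  refine ⟨v, hv0, fun u hu => ?_⟩
  have h1 := hv.trans_le (φ.strictMono.monotone hu)
  rw [inv_lt_iff_one_lt_mul₀' hM0] at h1
  rw [← hM]
  exact_mod_cast h1

/-- `cotype_disjoint` is applied with `w = u`, `b = a u`, `n` about `(2 K a) ^ q` and cells of
measure about `1 / (n φ(u))`; it yields `φ(a u) ≤ 2 n φ(u)`. -/
theorem upperGrowth_of_hasCotype {r : ArgumentRange} (hμ : r.Matches μ) {q : ℝ}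
    (h : HasCotype (φ.luxemburg μ) (q : EReal)) :
    ∃ C : ℝ≥0, 0 < C ∧ r.Holds fun a u => φ (a * u) ≤ C * a ^ q * φ u := by
  obtain ⟨hq, K, hK, h⟩ := h
  have hq0 : 0 < q := by exact_mod_cast hq
  lift K to ℝ≥0 using hK.le
  have hK0 : 0 < K := by exact_mod_cast hK
  have key : ∀ (n : ℕ) (a u : ℝ≥0), 0 < u → n ≠ 0 → (2 * K * a) ^ q ≤ n →
      r.Admits μ n (n * φ u) → φ (a * u) ≤ 2 * (n * φ u) := by
    intro n a u hu hn ha hadm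
    have hτ : 0 < n * φ u := mul_pos (by exact_mod_cast Nat.pos_of_ne_zero hn) (pos hu)
    obtain ⟨m, hm, hcells, h1, h2⟩ := hμ.exists_hasCells hτ hadm
    refine le_of_mul_le_one hm (cotype_disjoint hq0 hK h hcells h1 ?_) h2
    have h3 : (2 * K * (a * u)) ^ q ≤ n * u ^ q := by
      rw [← mul_assoc, NNReal.mul_rpow]
      gcongr
    exact_mod_cast h3
  set L : ℝ≥0 := (2 * K) ^ q + 1 with hL
  have hceil : ∀ a : ℝ≥0, 1 ≤ a → ∃ n : ℕ, n ≠ 0 ∧ (2 * K * a) ^ q ≤ n ∧ (n : ℝ≥0) ≤ L * a ^ q := by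
    intro a ha
    have ha0 : 0 < a := one_pos.trans_le ha
    refine ⟨⌈(2 * K * a) ^ q⌉₊, ?_, Nat.le_ceil _, ?_⟩
    · exact (Nat.ceil_pos.2 (NNReal.rpow_pos (by positivity))).ne'
    · refine (Nat.ceil_lt_add_one zero_le).le.trans ?_
      rw [hL, add_mul, one_mul, NNReal.mul_rpow]
      gcongr
      exact NNReal.one_le_rpow ha hq0.le
  cases r with
  | all =>
    refine ⟨2 * L, by positivity, fun a u ha => ?_⟩
    rcases eq_or_ne u 0 with rfl | hu
    · simp [φ.map_zero]
    obtain ⟨n, hn, h1, h2⟩ := hceil a ha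
    refine (key n a u (pos_iff_ne_zero.2 hu) hn h1 trivial).trans ?_
    rw [mul_assoc 2, mul_assoc 2]
    gcongr
  | large =>
    obtain ⟨v, hv, hv1⟩ := φ.exists_forall_ge_one_le hμ.2.1 hμ.2.2
    refine ⟨2 * L, by positivity, v, fun a u ha hu => ?_⟩
    obtain ⟨n, hn, h1, h2⟩ := hceil a ha
    refine (key n a u (hv.trans_le hu) hn h1 ?_).trans ?_
    · change (n : ℝ≥0∞) ≤ μ Set.univ * ((n * φ u : ℝ≥0) : ℝ≥0∞)
      calc (n : ℝ≥0∞) = n * 1 := (mul_one _).symm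
        _ ≤ n * (μ Set.univ * φ u) := by gcongr; exact (hv1 u hu).le
        _ = _ := by push_cast; ring
    · rw [mul_assoc 2, mul_assoc 2]
      gcongr
  | small =>
    refine ⟨(2 + φ 1) * L, by positivity, 1, one_pos, fun a u ha hu hau => ?_⟩
    obtain ⟨n, hn, h1, h2⟩ := hceil a ha
    -- Once `n φ(u) ≥ 1` suitable cells may be missing, but `φ(a u) ≤ φ(1)` already suffices.
    have h3 : φ (a * u) ≤ (2 + φ 1) * (n * φ u) := by
      rcases le_total (n * φ u) 1 with h4 | h4
      · refine (key n a u hu hn h1 h4).trans ?_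
        gcongr
        exact le_self_add
      · calc φ (a * u) ≤ φ 1 := φ.strictMono.monotone hau
          _ ≤ (2 + φ 1) * 1 := by rw [mul_one]; exact le_add_self
          _ ≤ _ := mul_le_mul_right h4 _
    refine h3.trans ?_
    rw [mul_assoc (2 + φ 1), mul_assoc (2 + φ 1)]
    gcongr

/-- `type_disjoint` is applied with `w = a u`, `b = u` and `n` the integer part of `(a / 2K) ^ p`;
it yields `n φ(u) ≤ 2 φ(a u)`. When `n = 0`, `a` is bounded and monotonicity is enough. -/
theorem lowerGrowth_of_hasType {r : ArgumentRange} (hμ : r.Matches μ) {p : ℝ}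
    (h : HasType (φ.luxemburg μ) p) :
    ∃ c : ℝ≥0, 0 < c ∧ r.Holds fun a u => c * a ^ p * φ u ≤ φ (a * u) := by
  obtain ⟨hp, K, hK, h⟩ := h
  lift K to ℝ≥0 using hK.le
  have hK0 : 0 < K := by exact_mod_cast hK
  have hb : ∀ (n : ℕ) (a u : ℝ≥0), n * (2 * K) ^ p ≤ a ^ p →
      (n : ℝ) * (2 * K * u) ^ p ≤ ((a * u : ℝ≥0) : ℝ) ^ p := by
    intro n a u ha
    have h3 : n * (2 * K * u) ^ p ≤ (a * u) ^ p := by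
      rw [NNReal.mul_rpow, NNReal.mul_rpow (x := a), ← mul_assoc]
      gcongr
    exact_mod_cast h3
  have key : ∀ (n : ℕ) (a u : ℝ≥0), 0 < a * u → n ≠ 0 → n * (2 * K) ^ p ≤ a ^ p →
      r.Admits μ n (φ (a * u)) → n * φ u ≤ 2 * φ (a * u) := by
    intro n a u hau hn ha hadm
    obtain ⟨m, hm, hcells, h1, h2⟩ := hμ.exists_hasCells (pos hau) hadm
    exact le_of_mul_le_one hm (type_disjoint hp hK h hn hcells h1 (hb n a u ha)) h2
  have h2K : 0 < (2 * K) ^ p := NNReal.rpow_pos (by positivity)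
  have finish : ∀ a u : ℝ≥0, 1 ≤ a → (∀ n : ℕ, n ≠ 0 → n * (2 * K) ^ p ≤ a ^ p →
      n * φ u ≤ 2 * φ (a * u)) → (4 * (2 * K) ^ p)⁻¹ * a ^ p * φ u ≤ φ (a * u) := by
    intro a u ha H
    rw [mul_assoc, inv_mul_le_iff₀ (by positivity)]
    have hmono : φ u ≤ φ (a * u) :=
      φ.strictMono.monotone (le_mul_of_one_le_left zero_le ha)
    set n := ⌊a ^ p / (2 * K) ^ p⌋₊ with hn
    have h1 : a ^ p ≤ (n + 1) * (2 * K) ^ p := by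
      rw [← div_le_iff₀ h2K]
      exact (Nat.lt_floor_add_one _).le
    rcases Nat.eq_zero_or_pos n with h0 | h0
    · rw [h0, Nat.cast_zero, zero_add, one_mul] at h1
      calc a ^ p * φ u ≤ (2 * K) ^ p * φ (a * u) := by gcongr
        _ ≤ 4 * (2 * K) ^ p * φ (a * u) := by
          rw [mul_assoc]
          exact le_mul_of_one_le_left zero_le (by norm_num)
    · have h2 : n * (2 * K) ^ p ≤ a ^ p := by
        rw [← le_div_iff₀ h2K]
        exact Nat.floor_le zero_le
      have h3 : (1 : ℝ≥0) ≤ n := by exact_mod_cast h0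
      calc a ^ p * φ u ≤ (n + 1) * (2 * K) ^ p * φ u := by gcongr
        _ ≤ (n + n) * (2 * K) ^ p * φ u := by gcongr
        _ = 2 * (2 * K) ^ p * (n * φ u) := by ring
        _ ≤ 2 * (2 * K) ^ p * (2 * φ (a * u)) := mul_le_mul_right (H n h0.ne' h2) _
        _ = _ := by ring
  refine ⟨(4 * (2 * K) ^ p)⁻¹, by positivity, ?_⟩
  cases r with
  | all =>
    intro a u ha
    rcases eq_or_ne u 0 with rfl | hu
    · simp [φ.map_zero]
    have hau : 0 < a * u := mul_pos (one_pos.trans_le ha) (pos_iff_ne_zero.2 hu)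
    exact finish a u ha fun n hn h1 => key n a u hau hn h1 trivial
  | large =>
    obtain ⟨v, hv, hv1⟩ := φ.exists_forall_ge_one_le hμ.2.1 hμ.2.2
    refine ⟨v, fun a u ha hu => finish a u ha fun n hn h1 => ?_⟩
    have hau : 0 < a * u := mul_pos (one_pos.trans_le ha) (hv.trans_le hu)
    rcases le_total (n : ℝ≥0∞) (μ Set.univ * φ (a * u)) with h2 | h2
    · exact key n a u hau hn h1 h2
    -- Here `n` cells of measure `1 / φ(a u)` need not fit. Cutting the whole space into `n` equal
    -- cells instead, the type estimate gives `μ(Ω) φ(u) ≤ 1`, against the choice of `v`.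
    · exfalso
      obtain ⟨M, hM⟩ : ∃ M : ℝ≥0, (M : ℝ≥0∞) = μ Set.univ := ⟨_, ENNReal.coe_toNNReal hμ.2.2.ne⟩
      have hn0 : (0 : ℝ≥0) < n := by exact_mod_cast Nat.pos_of_ne_zero hn
      have hnM : n * (M / n) = M := mul_div_cancel₀ M hn0.ne'
      have hcells : HasCells μ (Fin n) (M / n) := hμ.1.hasCells n (by rw [hnM, hM])
      have h3 : M / n * φ (a * u) ≤ 1 := by
        rw [div_mul_eq_mul_div, div_le_one hn0]
        rw [← hM] at h2
        exact_mod_cast h2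
      have h4 := type_disjoint hp hK h hn hcells h3 (hb n a u h1)
      rw [mul_left_comm, ← mul_assoc, hnM] at h4
      have h5 := hv1 u hu
      rw [← hM] at h5
      exact absurd h4 (not_le.2 (by exact_mod_cast h5))
  | small =>
    obtain ⟨v, hv, hv1⟩ := φ.exists_pos_mul_le 1 one_pos
    rw [mul_one] at hv1
    refine ⟨v, hv, fun a u ha hu hau => finish a u ha fun n hn h1 => ?_⟩
    exact key n a u (mul_pos (one_pos.trans_le ha) hu) hn h1
      ((φ.strictMono.monotone hau).trans hv1)

/-- About `log₂ a` doublings, each costing `2 ^ d`, amount to the power `a ^ d`. Doubling is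
required only at `b u` with `1 ≤ b ≤ a`, so that it is available for small arguments too. -/
theorem iterate_doubling {d : ℕ} {a u : ℝ≥0} (ha : 1 ≤ a)
    (h : ∀ b, 1 ≤ b → b * 2 ≤ 2 * a → φ (2 * (b * u)) ≤ 2 ^ d * φ (b * u)) :
    φ (a * u) ≤ 2 ^ d * a ^ (d : ℝ) * φ u := by
  have key : ∀ (j : ℕ) (a : ℝ≥0), 1 ≤ a → a ≤ 2 ^ j →
      (∀ b, 1 ≤ b → b * 2 ≤ 2 * a → φ (2 * (b * u)) ≤ 2 ^ d * φ (b * u)) →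
      φ (a * u) ≤ (2 ^ d) ^ j * φ u := by
    intro j
    induction j with
    | zero =>
      intro a ha ha1 _
      rw [pow_zero] at ha1
      rw [le_antisymm ha1 ha, pow_zero, one_mul, one_mul]
    | succ j ih =>
      intro a ha haj H
      rcases le_total a 2 with h2 | h2
      · have h1 := H 1 le_rfl (by rw [one_mul]; exact le_mul_of_one_le_right zero_le ha)
        rw [one_mul] at h1
        calc φ (a * u) ≤ φ (2 * u) := φ.strictMono.monotone (by gcongr)
          _ ≤ 2 ^ d * φ u := h1
          _ ≤ (2 ^ d) ^ (j + 1) * φ u := by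
            refine mul_le_mul_left ?_ _
            rw [pow_succ]
            exact le_mul_of_one_le_left zero_le (one_le_pow₀ (one_le_pow₀ one_le_two))
      · have ha2 : 1 ≤ a / 2 := (one_le_div two_pos).2 h2
        have e : a / 2 * 2 = a := div_mul_cancel₀ a two_ne_zero
        have hle : a / 2 ≤ a := half_le_self zero_le
        have h1 := H (a / 2) ha2 (by rw [mul_comm]; gcongr)
        rw [← mul_assoc, mul_comm 2, e] at h1
        have h3 := ih (a / 2) ha2 (by rw [div_le_iff₀ two_pos, ← pow_succ]; exact haj)
          fun b hb hba => H b hb (hba.trans (by gcongr))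
        calc φ (a * u) ≤ 2 ^ d * φ (a / 2 * u) := h1
          _ ≤ 2 ^ d * ((2 ^ d) ^ j * φ u) := by gcongr
          _ = _ := by ring
  obtain ⟨j, hj1, hj2⟩ := exists_nat_pow_near ha (one_lt_two : (1 : ℝ≥0) < 2)
  refine (key (j + 1) a ha hj2.le h).trans ?_
  gcongr
  rw [NNReal.rpow_natCast, pow_succ, mul_comm, ← pow_mul, mul_comm d j, pow_mul]
  gcongr

/-- Because `p > 1`, `n ^ (1 / p)` is of smaller order than `n`, so some `n` satisfies the
hypothesis of `type_doubling`. This fixed `n` gives the doubling constant `2 ^ (n + 1)`, hence a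
finite growth exponent `n + 1`, with no claim to sharpness. -/
theorem upperGrowth_of_hasType {r : ArgumentRange} (hμ : r.Matches μ) {p : ℝ} (hp1 : 1 < p)
    (h : HasType (φ.luxemburg μ) p) :
    ∃ (q : ℝ) (C : ℝ≥0), 0 < C ∧ r.Holds fun a u => φ (a * u) ≤ C * a ^ q * φ u := by
  obtain ⟨hp, K, hK, h⟩ := h
  obtain ⟨n, hn⟩ : ∃ n : ℕ, 2 * K * (n : ℝ) ^ p⁻¹ < n := by
    by_contra! hcon
    have h1 : (1 : ℝ) ≤ p⁻¹ := le_of_forall_natCast_rpow_le (K := 2 * K) fun n _ => by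
      rw [Real.rpow_one]; exact hcon n
    exact absurd h1 (not_le.2 (inv_lt_one_of_one_lt₀ hp1))
  have key : ∀ u : ℝ≥0, 0 < u → r.Admits μ (2 ^ n) (2 ^ n * φ u) →
      φ (2 * u) ≤ 2 ^ (n + 1) * φ u := by
    intro u hu hadm
    obtain ⟨m, hm, hcells, h1, h2⟩ := hμ.exists_hasCells
      (mul_pos (by positivity) (pos hu) : 0 < 2 ^ n * φ u) hadm
    refine (le_of_mul_le_one hm (type_doubling hp h hK hn hcells h1) h2).trans (le_of_eq ?_)
    ring
  refine ⟨(n + 1 : ℕ), 2 ^ (n + 1), by positivity, ?_⟩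
  cases r with
  | all =>
    intro a u ha
    refine iterate_doubling ha fun b hb _ => ?_
    rcases eq_or_ne u 0 with rfl | hu
    · simp [φ.map_zero]
    · exact key _ (mul_pos (one_pos.trans_le hb) (pos_iff_ne_zero.2 hu)) trivial
  | large =>
    obtain ⟨v, hv, hv1⟩ := φ.exists_forall_ge_one_le hμ.2.1 hμ.2.2
    refine ⟨v, fun a u ha hu => iterate_doubling ha fun b hb _ => ?_⟩
    have hbu : v ≤ b * u := hu.trans (le_mul_of_one_le_left zero_le hb)
    refine key _ (hv.trans_le hbu) ?_
    change ((2 ^ n : ℕ) : ℝ≥0∞) ≤ μ Set.univ * ((2 ^ n * φ (b * u) : ℝ≥0) : ℝ≥0∞)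
    calc ((2 ^ n : ℕ) : ℝ≥0∞) = 2 ^ n * 1 := by push_cast; ring
      _ ≤ 2 ^ n * (μ Set.univ * φ (b * u)) := by gcongr; exact (hv1 _ hbu).le
      _ = _ := by push_cast; ring
  | small =>
    obtain ⟨v, hv, hv1⟩ := φ.exists_pos_mul_le (2 ^ n) one_pos
    refine ⟨v, hv, fun a u ha hu hau => iterate_doubling ha fun b hb hba => ?_⟩
    have hba' : b ≤ a := by
      rw [mul_comm] at hba
      exact le_of_mul_le_mul_left hba two_pos
    refine key _ (mul_pos (one_pos.trans_le hb) hu) ?_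
    change 2 ^ n * φ (b * u) ≤ 1
    refine le_trans ?_ hv1
    rw [mul_comm]
    gcongr
    exact φ.strictMono.monotone ((mul_le_mul_left hba' u).trans hau)

end OrliczFunction

theorem mainTheorem10 {Ω : Type*} [MeasurableSpace Ω] (μ : Measure Ω) (r : ArgumentRange)
    (hμ : r.Matches μ) (φ : OrliczFunction) (hα : 0 < φ.lowerIndex r) :
    ((∀ ε : ℝ, 0 < ε → HasCotype (φ.luxemburg μ) (max (φ.upperIndex r + ε) 2)) ∧
      (∀ q : ℝ, HasCotype (φ.luxemburg μ) (q : EReal) → max (φ.upperIndex r) 2 ≤ (q : EReal))) ∧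
    ((φ.upperIndex r < ⊤ → ∀ ε : ℝ, 0 < ε → 0 < φ.lowerIndex r - ε →
        HasType (φ.luxemburg μ) (min (φ.lowerIndex r - ε) 2).toReal) ∧
      (∀ p : ℝ, 1 < p → HasType (φ.luxemburg μ) p →
        φ.upperIndex r < ⊤ ∧ (p : EReal) ≤ min (φ.lowerIndex r) 2)) := by
  refine ⟨⟨fun ε hε => OrliczFunction.hasCotype_of_upperIndex hμ hα hε, fun q hq => ?_⟩,
    fun hβ ε hε hαε => OrliczFunction.hasType_of_lowerIndex hμ hβ hε hαε, fun p hp1 hp => ?_⟩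
  · obtain ⟨C, hC, h⟩ := OrliczFunction.upperGrowth_of_hasCotype hμ hq
    refine max_le (sInf_le ⟨q, rfl, C, hC, h⟩) ?_
    exact EReal.coe_le_coe_iff.2 (OrliczFunction.two_le_of_hasCotype hμ hq)
  · obtain ⟨q, C, hC, h⟩ := OrliczFunction.upperGrowth_of_hasType hμ hp1 hp
    obtain ⟨c, hc, h'⟩ := OrliczFunction.lowerGrowth_of_hasType hμ hp
    refine ⟨(sInf_le ⟨q, rfl, C, hC, h⟩ : φ.upperIndex r ≤ q).trans_lt (EReal.coe_lt_top q),
      le_min (le_sSup ⟨p, rfl, c, hc, h'⟩) ?_⟩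
    exact EReal.coe_le_coe_iff.2 (OrliczFunction.le_two_of_hasType hμ hp)
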